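/- **Conventions.** Algorithms are deterministic machines with finitely many stacks of bits that count steps; one step inspects or changes one top symbol, and an oracle query costs one step (polynomially equivalent to multitape oracle Turing machines). A *$\mathsf{P}^{\mathsf{NP}}$-algorithm* is one that runs in time polynomial in its input size with oracle access to a fixed problem in $\mathsf{NP}$. $\Sigma_2^{\mathsf P}$ is the class of problems $A\subseteq\{0,1\}^*$ solved by an $\mathsf{NP}$-machine with an oracle for a problem in $\mathsf{NP}$ (i.e. with certificates of polynomial length that are checked by a $\mathsf{P}^{\mathsf{NP}}$-algorithm); $\Pi_2^{\mathsf P}$ is the class of their complements; $\Sigma_2^{\mathsf P}/\mathsf{poly}$ is defined as $\Sigma_2^{\mathsf P}$, but the machine also receives an advice string that depends only on the length of the input and has length polynomial in it. A problem $L$ is $\Sigma_2^{\mathsf P}$-hard if every problem in $\Sigma_2^{\mathsf P}$ is polynomial-time many-one reducible to $L$. A *parameterized problem* is a set $P\subseteq\{0,1\}^*\times\mathbb N$; an instance $(x,r)$ has size $|x|+r$. * An equivalence relation $R$ on $\{0,1\}^*$ is a *polynomial $\mathsf{P}^{\mathsf{NP}}$-equivalence relation* if a $\mathsf{P}^{\mathsf{NP}}$-algorithm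 decides whether two given strings are $R$-equivalent, and there is a polynomial $b$ such that every finite set $S$ of strings meets at most $b(\max_{x\in S}|x|)$ classes of $R$. * $L\subseteq\{0,1\}^*$ *$\mathsf{P}^{\mathsf{NP}}$-OR-cross-composes* into $P$ if, for some polynomial $\mathsf{P}^{\mathsf{NP}}$-equivalence relation $R$, there are a $\mathsf{P}^{\mathsf{NP}}$-algorithm and a polynomial $b$ such that, given $t\ge 1$ pairwise $R$-equivalent strings $x_1,\dots,x_t$ (encoded as one string of length $\sum_{i}(2|x_i|+1)$), the algorithm outputs a pair $(y,k)$ with $k\le b(\max_i|x_i|+\lfloor\log_2 t\rfloor)$ and $(y,k)\in P\iff x_i\in L$ for some $i$. * $P$ has a *polynomial $\mathsf{P}^{\mathsf{NP}}$-kernel* if there are a $\mathsf{P}^{\mathsf{NP}}$-algorithm and a polynomial $b$ such that the algorithm maps every $(x,r)$ to some $(x',r')$ with $|x'|+r'\le b(r)$ and $(x',r')\in P\iff(x,r)\in P$. * $P$ has a *polynomial $\mathsf{P}^{\mathsf{NP}}$-compression* into $Q\subseteq\{0,1\}^*$ if there are a $\mathsf{P}^{\mathsf{NP}}$-algorithm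 and a polynomial $b$ such that the algorithm maps every $(x,r)$ to some string $y$ with $|y|\le b(r)$ and $y\in Q\iff(x,r)\in P$. **Theorem.** Let $L\subseteq\{0,1\}^*$ be $\Sigma_2^{\mathsf P}$-hard and let $P\subseteq\{0,1\}^*\times\mathbb N$ be a parameterized problem such that $L$ $\mathsf{P}^{\mathsf{NP}}$-OR-cross-composes into $P$. Then, unless $\Pi_2^{\mathsf P}\subseteq\Sigma_2^{\mathsf P}/\mathsf{poly}$, the problem $P$ has no polynomial $\mathsf{P}^{\mathsf{NP}}$-kernel and, more generally, no polynomial $\mathsf{P}^{\mathsf{NP}}$-compression into any problem $Q\subseteq\{0,1\}^*$. -/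

import Mathlib

namespace PNP

/-- A (decision) problem: a set of bit strings. -/
abbrev Problem := Set (List Bool)

/-- A parameterized problem: a set of pairs of a bit string and a natural number, the parameter. -/
abbrev ParamProblem := Set (List Bool × ℕ)

/-! ### Oracle machines with a step count

The machine model is a multi-stack oracle machine with structured control. A machine owns stacks of
bits, numbered by natural numbers (a program mentions only finitely many of them); the top of a
stack is the head of the list. Every elementary instruction looks at or changes one top symbol only
and costs one step; a query to the oracle costs one step as well. Two stacks are one Turing tape,
and the finite control of a Turing machine is kept on a further stack, so that these machines and
multitape oracle Turing machines simulate each other with constant slowdown. -/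

/-- Programs of multi-stack oracle machines. -/
inductive Prog : Type where
  /-- do nothing -/
  | skip : Prog
  /-- push the bit `b` on stack `i` -/
  | push (i : ℕ) (b : Bool) : Prog
  /-- remove the top symbol of stack `i`, if there is one -/
  | pop (i : ℕ) : Prog
  /-- ask the oracle about the content of stack `i`, which is replaced by the one-bit answer -/
  | query (i : ℕ) : Prog
  /-- first `c`, then `d` -/
  | seq (c d : Prog) : Prog
  /-- `c` if stack `i` is empty, `d` if its top is `false`, `e` if its top is `true` -/
  | cond (i : ℕ) (c d e : Prog) : Prog
  /-- repeat `c` while stack `i` is non-empty -/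
  | loop (i : ℕ) (c : Prog) : Prog

/-- The contents of the stacks. -/
abbrev Store := ℕ → List Bool

/-- `Run O c s n t`: with oracle `O`, the program `c` started on the stacks `s` halts after exactly
`n` steps and leaves the stacks `t`. -/
inductive Run (O : Problem) : Prog → Store → ℕ → Store → Prop where
  | skip (s : Store) : Run O Prog.skip s 1 s
  | push (i : ℕ) (b : Bool) (s : Store) :
      Run O (Prog.push i b) s 1 (Function.update s i (b :: s i))
  | pop (i : ℕ) (s : Store) : Run O (Prog.pop i) s 1 (Function.update s i (s i).tail)
  | query_yes (i : ℕ) (s : Store) (h : s i ∈ O) :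
      Run O (Prog.query i) s 1 (Function.update s i [true])
  | query_no (i : ℕ) (s : Store) (h : s i ∉ O) :
      Run O (Prog.query i) s 1 (Function.update s i [false])
  | seq {c d : Prog} {s t u : Store} {m n : ℕ} (hc : Run O c s m t) (hd : Run O d t n u) :
      Run O (Prog.seq c d) s (m + n) u
  | cond_nil {i : ℕ} {c d e : Prog} {s t : Store} {n : ℕ} (h : s i = [])
      (hc : Run O c s n t) : Run O (Prog.cond i c d e) s (n + 1) t
  | cond_false {i : ℕ} {c d e : Prog} {s t : Store} {n : ℕ} (h : (s i).head? = some false)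
      (hd : Run O d s n t) : Run O (Prog.cond i c d e) s (n + 1) t
  | cond_true {i : ℕ} {c d e : Prog} {s t : Store} {n : ℕ} (h : (s i).head? = some true)
      (he : Run O e s n t) : Run O (Prog.cond i c d e) s (n + 1) t
  | loop_done {i : ℕ} {c : Prog} {s : Store} (h : s i = []) : Run O (Prog.loop i c) s 1 s
  | loop_step {i : ℕ} {c : Prog} {s t u : Store} {m n : ℕ} (h : s i ≠ [])
      (hc : Run O c s m t) (hl : Run O (Prog.loop i c) t n u) :
      Run O (Prog.loop i c) s (m + n + 1) u

/-- The machines are deterministic: the number of steps and the final stacks are unique. -/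
theorem Run.unique {O : Problem} {c : Prog} {s t : Store} {n : ℕ} (h : Run O c s n t) :
    ∀ {n' : ℕ} {t' : Store}, Run O c s n' t' → n = n' ∧ t = t' := by
  induction h with
  | skip s => intro n' t' h'; cases h'; simp
  | push i b s => intro n' t' h'; cases h'; simp
  | pop i s => intro n' t' h'; cases h'; simp
  | query_yes i s h => intro n' t' h'; cases h' <;> simp_all
  | query_no i s h => intro n' t' h'; cases h' <;> simp_all
  | seq _ _ ih1 ih2 =>
    intro n' t' h'
    cases h' with
    | seq g1 g2 =>
      obtain ⟨rfl, rfl⟩ := ih1 g1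
      obtain ⟨rfl, rfl⟩ := ih2 g2
      simp
  | cond_nil h _ ih =>
    intro n' t' h'
    cases h' with
    | cond_nil g k => obtain ⟨rfl, rfl⟩ := ih k; simp
    | cond_false g k => simp [h] at g
    | cond_true g k => simp [h] at g
  | cond_false h _ ih =>
    intro n' t' h'
    cases h' with
    | cond_nil g k => simp [g] at h
    | cond_false g k => obtain ⟨rfl, rfl⟩ := ih k; simp
    | cond_true g k => simp [h] at g
  | cond_true h _ ih =>
    intro n' t' h'
    cases h' with
    | cond_nil g k => simp [g] at h
    | cond_false g k => simp [h] at g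
    | cond_true g k => obtain ⟨rfl, rfl⟩ := ih k; simp
  | loop_done h =>
    intro n' t' h'
    cases h' with
    | loop_done g => simp
    | loop_step g k l => exact absurd h g
  | loop_step h _ _ ih1 ih2 =>
    intro n' t' h'
    cases h' with
    | loop_done g => exact absurd g h
    | loop_step g k l =>
      obtain ⟨rfl, rfl⟩ := ih1 k
      obtain ⟨rfl, rfl⟩ := ih2 l
      simp

/-- The initial stacks on the inputs `xs`: the `i`-th input is on stack `i`, counting from `0`, and
all other stacks are empty. -/
def input (xs : List (List Bool)) : Store := fun i => xs.getD i []

/-- The program `c` with oracle `O` halts on the inputs `xs` after at most `n` steps. -/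
def HaltsWithin (O : Problem) (c : Prog) (xs : List (List Bool)) (n : ℕ) : Prop :=
  ∃ m ≤ n, ∃ s, Run O c (input xs) m s

/-- The program `c` with oracle `O` accepts the inputs `xs`: it halts with the bit `true` on top of
stack `0`. -/
def Accepts (O : Problem) (c : Prog) (xs : List (List Bool)) : Prop :=
  ∃ m s, Run O c (input xs) m s ∧ (s 0).head? = some true

/-- The program `c` with oracle `O`, on the inputs `xs`, halts after at most `n` steps with the
final stacks `s`. -/
def OutputsWithin (O : Problem) (c : Prog) (xs : List (List Bool)) (n : ℕ) (s : Store) : Prop :=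
  ∃ m ≤ n, Run O c (input xs) m s

/-- A natural number written in unary. -/
def unary (k : ℕ) : List Bool := List.replicate k true

/-- A finite sequence of strings as one string: every bit is preceded by `true`, and every string
is closed by `false`. -/
def encodeList (xs : List (List Bool)) : List Bool :=
  xs.flatMap fun x => (x.flatMap fun b => [true, b]) ++ [false]

/-! ### Complexity classes -/

/-- `NP` relative to the oracle `O`: membership has certificates of polynomial length that are
checked by a deterministic polynomial-time machine with oracle `O`. -/
def NPWithOracle (O : Problem) : Set Problem :=
  {L | ∃ (V : Prog) (p q : Polynomial ℕ),
    (∀ x w : List Bool, HaltsWithin O V [x, w] (q.eval (x.length + w.length))) ∧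
    ∀ x : List Bool, x ∈ L ↔ ∃ w : List Bool, w.length ≤ p.eval x.length ∧ Accepts O V [x, w]}

/-- The class `NP`: there is no oracle, that is, it answers every query with `false`. -/
def NP : Set Problem := NPWithOracle ∅

/-- The class `Σ₂ᴾ`, that is, `NP` with an oracle for a problem in `NP`. -/
def SigmaTwo : Set Problem := {L | ∃ O ∈ NP, L ∈ NPWithOracle O}

/-- The class `Π₂ᴾ` of the complements of the problems in `Σ₂ᴾ`. -/
def PiTwo : Set Problem := {L | Lᶜ ∈ SigmaTwo}

/-- The class `Σ₂ᴾ/poly`: as `Σ₂ᴾ`, but the machine gets as a further input an advice string of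
polynomial length, which depends only on the length of the input. -/
def SigmaTwoPoly : Set Problem :=
  {L | ∃ O ∈ NP, ∃ (V : Prog) (p q r : Polynomial ℕ) (advice : ℕ → List Bool),
    (∀ n, (advice n).length ≤ r.eval n) ∧
    (∀ x a w : List Bool,
      HaltsWithin O V [x, a, w] (q.eval (x.length + a.length + w.length))) ∧
    ∀ x : List Bool, x ∈ L ↔
      ∃ w : List Bool, w.length ≤ p.eval x.length ∧ Accepts O V [x, advice x.length, w]}

/-- Polynomial-time many-one reducibility (without an oracle). -/
def PolyReducible (A L : Problem) : Prop :=
  ∃ (c : Prog) (q : Polynomial ℕ), ∀ x : List Bool, ∃ s : Store,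
    OutputsWithin ∅ c [x] (q.eval x.length) s ∧ (x ∈ A ↔ s 0 ∈ L)

/-- Hardness for `Σ₂ᴾ` under polynomial-time many-one reductions. -/
def SigmaTwoHard (L : Problem) : Prop := ∀ A ∈ SigmaTwo, PolyReducible A L

/-! ### Kernels, compressions and cross-compositions with an `NP` oracle

The parameter is written in unary, so that the size of an instance `(x, r)` is `|x| + r`. -/

/-- `P` has a polynomial `Pᴺᴾ`-kernel. A pair `(x, r)` is given and returned with the string on
stack `0` and the parameter on stack `1`. -/
def HasPolyKernel (P : ParamProblem) : Prop :=
  ∃ O ∈ NP, ∃ (c : Prog) (q b : Polynomial ℕ), ∀ (x : List Bool) (r : ℕ),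
    ∃ (s : Store) (x' : List Bool) (r' : ℕ),
      OutputsWithin O c [x, unary r] (q.eval (x.length + r)) s ∧
      s 0 = x' ∧ s 1 = unary r' ∧
      x'.length + r' ≤ b.eval r ∧
      ((x', r') ∈ P ↔ (x, r) ∈ P)

/-- `P` has a polynomial `Pᴺᴾ`-compression into the problem `Q`. -/
def HasPolyCompression (P : ParamProblem) (Q : Problem) : Prop :=
  ∃ O ∈ NP, ∃ (c : Prog) (q b : Polynomial ℕ), ∀ (x : List Bool) (r : ℕ),
    ∃ (s : Store) (y : List Bool),
      OutputsWithin O c [x, unary r] (q.eval (x.length + r)) s ∧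
      s 0 = y ∧
      y.length ≤ b.eval r ∧
      (y ∈ Q ↔ (x, r) ∈ P)

/-- `R` is a polynomial `Pᴺᴾ`-equivalence relation: equivalence of two strings is decided in
polynomial time with an `NP` oracle, and the number of classes that meet a finite set `S` of strings
is polynomially bounded in the maximum length of a string in `S`. -/
def IsPolyEquivalence (R : Setoid (List Bool)) : Prop :=
  (∃ O ∈ NP, ∃ (c : Prog) (q : Polynomial ℕ), ∀ x y : List Bool,
    HaltsWithin O c [x, y] (q.eval (x.length + y.length)) ∧
    (Accepts O c [x, y] ↔ R x y)) ∧
  ∃ b : Polynomial ℕ, ∀ S : Finset (List Bool),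
    ((fun x => Quotient.mk R x) '' (S : Set (List Bool))).ncard ≤ b.eval (S.sup List.length)

/-- `L` has a `Pᴺᴾ`-OR-cross-composition into `P` with respect to `R`. The machine is only asked to
work on non-empty sequences `xs` of `R`-equivalent strings; it returns the string on stack `0` and
the parameter on stack `1`. -/
def ORCrossComposesWrt (R : Setoid (List Bool)) (L : Problem) (P : ParamProblem) : Prop :=
  ∃ O ∈ NP, ∃ (c : Prog) (q b : Polynomial ℕ), ∀ xs : List (List Bool), xs ≠ [] →
    (∀ x ∈ xs, ∀ y ∈ xs, R x y) →
    ∃ (s : Store) (y : List Bool) (k : ℕ),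
      OutputsWithin O c [encodeList xs] (q.eval (encodeList xs).length) s ∧
      s 0 = y ∧ s 1 = unary k ∧
      k ≤ b.eval (xs.toFinset.sup List.length + Nat.log 2 xs.length) ∧
      ((y, k) ∈ P ↔ ∃ x ∈ xs, x ∈ L)

/-- `L` `Pᴺᴾ`-OR-cross-composes into `P`, with respect to some polynomial `Pᴺᴾ`-equivalence
relation. -/
def ORCrossComposes (L : Problem) (P : ParamProblem) : Prop :=
  ∃ R : Setoid (List Bool), IsPolyEquivalence R ∧ ORCrossComposesWrt R L P

end PNP

/-! Let `A` be in Π₂ᴾ. Its complement reduces to `L` by some `ρ`, so `x ∈ A` means `ρ x ∉ L`.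
Cross-composing a tuple of equivalent strings and then compressing gives a map `f` with `f xs ∈ Q`
iff some entry of `xs` lies in `L`. The length of `f xs` is polynomial in the maximal entry length
`m` plus the logarithm of the number `t` of entries. Hence a `t` polynomial in `m` exceeds this
length (`exists_polynomial_tuple_length`), and then `f` has at most `2 ^ t` possible values on such
tuples.

Consider one equivalence class and the set `C` of no-instances `ρ x` in it, with `x` of length `n`.
All `t`-tuples over `C` are mapped to strings outside `Q`. By pigeonhole some value `y` is such that
the tuples mapped to `y` involve at least half of `C`. Removing these elements and repeating, `n +
1` values cover all of `C` (`exists_covering_values`). Polynomially many classes occur, so the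
values collected over all of them form a polynomial-size advice (`exists_certifying_values`).

To certify `x ∈ A`, guess a tuple of strings equivalent to `ρ x` that contains `ρ x` and whose
`f`-value is listed in the advice. Such a tuple exists by the covering. Conversely, the listed
values lie outside `Q`, so no entry of the tuple lies in `L`, in particular not `ρ x`. Checking a
certificate takes polynomial time with an `NP` oracle (`exists_verifier`), so `A` is in Σ₂ᴾ/poly
(`piTwo_subset_of_hasPolyCompression`). A kernel is a special compression.

The remaining work is programming: subroutine calls (`run_call`), composable polynomial time bounds
(`PolyRun`, `PolyStep`), list scanning (`Decides.forall_mem`), and one `NP` oracle that answers for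
several (`join_mem_NP`). -/

namespace PNP

open Function

/-! ### General facts about runs -/

/-- A step lengthens a stack by at most one symbol. -/
theorem Run.length_le {O : Problem} {c : Prog} {s t : Store} {n : ℕ} (h : Run O c s n t) (j : ℕ) :
    (t j).length ≤ (s j).length + n := by
  induction h with
  | skip s => simp
  | push i b s => by_cases hj : j = i <;> simp [hj]
  | pop i s =>
    by_cases hj : j = i
    · subst hj; simp; omega
    · simp [hj]
  | query_yes i s h => by_cases hj : j = i <;> simp [hj]
  | query_no i s h => by_cases hj : j = i <;> simp [hj]
  | seq _ _ ih1 ih2 => omega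
  | cond_nil h _ ih => omega
  | cond_false h _ ih => omega
  | cond_true h _ ih => omega
  | loop_done h => omega
  | loop_step h _ _ ih1 ih2 => omega

/-- A strict upper bound for the stacks a program mentions. -/
def Prog.bound : Prog → ℕ
  | .skip => 0
  | .push i _ => i + 1
  | .pop i => i + 1
  | .query i => i + 1
  | .seq c d => max c.bound d.bound
  -- Stacks that are only tested do not count, here and for `loop`: only those that can change
  -- matter for `Run.eq_of_bound_le`.
  | .cond _ c d e => max c.bound (max d.bound e.bound)
  | .loop _ c => c.bound

theorem Run.eq_of_bound_le {O : Problem} {c : Prog} {s t : Store} {n : ℕ} (h : Run O c s n t)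
    {j : ℕ} (hj : c.bound ≤ j) : t j = s j := by
  induction h with
  | skip s => rfl
  | push i b s => exact update_of_ne (by simp only [Prog.bound] at hj; omega) _ _
  | pop i s => exact update_of_ne (by simp only [Prog.bound] at hj; omega) _ _
  | query_yes i s h => exact update_of_ne (by simp only [Prog.bound] at hj; omega) _ _
  | query_no i s h => exact update_of_ne (by simp only [Prog.bound] at hj; omega) _ _
  | seq _ _ ih1 ih2 =>
    simp only [Prog.bound, max_le_iff] at hj
    rw [ih2 hj.2, ih1 hj.1]
  | cond_nil h _ ih => simp only [Prog.bound, max_le_iff] at hj; exact ih hj.1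
  | cond_false h _ ih => simp only [Prog.bound, max_le_iff] at hj; exact ih hj.2.1
  | cond_true h _ ih => simp only [Prog.bound, max_le_iff] at hj; exact ih hj.2.2
  | loop_done h => rfl
  | loop_step h _ _ ih1 ih2 => rw [ih2 hj, ih1 hj]

/-- Renaming the stacks of a program. -/
def Prog.rename (f : ℕ → ℕ) : Prog → Prog
  | .skip => .skip
  | .push i b => .push (f i) b
  | .pop i => .pop (f i)
  | .query i => .query (f i)
  | .seq c d => .seq (c.rename f) (d.rename f)
  | .cond i c d e => .cond (f i) (c.rename f) (d.rename f) (e.rename f)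
  | .loop i c => .loop (f i) (c.rename f)

theorem update_extend {f : ℕ → ℕ} (hf : Injective f) (s S : Store) (i : ℕ) (v : List Bool) :
    update (extend f s S) (f i) v = extend f (update s i v) S := by
  funext j
  by_cases hj : ∃ k, f k = j
  · obtain ⟨k, rfl⟩ := hj
    rw [hf.extend_apply]
    by_cases hk : k = i
    · subst hk; simp
    · rw [update_of_ne (fun h => hk (hf h)), update_of_ne hk, hf.extend_apply]
  · rw [extend_apply' _ _ _ hj, update_of_ne (fun h => hj ⟨i, h.symm⟩), extend_apply' _ _ _ hj]

/-- Frame rule: a program with injectively renamed stacks does not touch the other stacks. -/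
theorem Run.rename {O : Problem} {c : Prog} {s t : Store} {n : ℕ} {f : ℕ → ℕ} (hf : Injective f)
    (S : Store) (h : Run O c s n t) : Run O (c.rename f) (extend f s S) n (extend f t S) := by
  induction h with
  | skip s => exact .skip _
  | push i b s =>
    have := Run.push (O := O) (f i) b (extend f s S)
    rwa [update_extend hf, hf.extend_apply] at this
  | pop i s =>
    have := Run.pop (O := O) (f i) (extend f s S)
    rwa [update_extend hf, hf.extend_apply] at this
  | query_yes i s h =>
    have := Run.query_yes (O := O) (f i) (extend f s S) (by rwa [hf.extend_apply])
    rwa [update_extend hf] at this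
  | query_no i s h =>
    have := Run.query_no (O := O) (f i) (extend f s S) (by rwa [hf.extend_apply])
    rwa [update_extend hf] at this
  | seq _ _ ih1 ih2 => exact .seq ih1 ih2
  | cond_nil h _ ih => exact .cond_nil (by rwa [hf.extend_apply]) ih
  | cond_false h _ ih => exact .cond_false (by rwa [hf.extend_apply]) ih
  | cond_true h _ ih => exact .cond_true (by rwa [hf.extend_apply]) ih
  | loop_done h => exact .loop_done (by rwa [hf.extend_apply])
  | loop_step h _ _ ih1 ih2 => exact .loop_step (by rwa [hf.extend_apply]) ih1 ih2

/-- The program that marks every oracle query with the bit `b`. -/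
def Prog.mark (b : Bool) : Prog → Prog
  | .skip => .skip
  | .push i b => .push i b
  | .pop i => .pop i
  | .query i => .seq (.push i b) (.query i)
  | .seq c d => .seq (c.mark b) (d.mark b)
  | .cond i c d e => .cond i (c.mark b) (d.mark b) (e.mark b)
  | .loop i c => .loop i (c.mark b)

/-- The answer overwrites the whole queried stack, so the mark leaves no trace. Each query costs one
extra step, whence the factor 2. -/
theorem Run.mark {O O' : Problem} {b : Bool} (hO : ∀ x, b :: x ∈ O' ↔ x ∈ O)
    {c : Prog} {s t : Store} {n : ℕ} (h : Run O c s n t) :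
    ∃ m ≤ 2 * n, Run O' (c.mark b) s m t := by
  induction h with
  | skip s => exact ⟨1, by omega, .skip _⟩
  | push i b s => exact ⟨1, by omega, .push _ _ _⟩
  | pop i s => exact ⟨1, by omega, .pop _ _⟩
  | query_yes i s h =>
    refine ⟨1 + 1, by omega, .seq (.push _ _ _) ?_⟩
    have := Run.query_yes (O := O') i (update s i (b :: s i)) (by simpa [hO] using h)
    rwa [update_idem] at this
  | query_no i s h =>
    refine ⟨1 + 1, by omega, .seq (.push _ _ _) ?_⟩
    have := Run.query_no (O := O') i (update s i (b :: s i)) (by simpa [hO] using h)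
    rwa [update_idem] at this
  | seq _ _ ih1 ih2 =>
    obtain ⟨m1, h1, r1⟩ := ih1
    obtain ⟨m2, h2, r2⟩ := ih2
    exact ⟨m1 + m2, by omega, .seq r1 r2⟩
  | cond_nil h _ ih => obtain ⟨m, hm, r⟩ := ih; exact ⟨m + 1, by omega, .cond_nil h r⟩
  | cond_false h _ ih => obtain ⟨m, hm, r⟩ := ih; exact ⟨m + 1, by omega, .cond_false h r⟩
  | cond_true h _ ih => obtain ⟨m, hm, r⟩ := ih; exact ⟨m + 1, by omega, .cond_true h r⟩
  | loop_done h => exact ⟨1, by omega, .loop_done h⟩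
  | loop_step h _ _ ih1 ih2 =>
    obtain ⟨m1, h1, r1⟩ := ih1
    obtain ⟨m2, h2, r2⟩ := ih2
    exact ⟨m1 + m2 + 1, by omega, .loop_step h r1 r2⟩

/-- Every program with oracle `O` can be simulated, with constant slowdown, with oracle `O'`. -/
def Simulates (O' O : Problem) : Prop :=
  ∀ c : Prog, ∃ (c' : Prog) (K : ℕ), ∀ s n t, Run O c s n t → ∃ m ≤ K * n, Run O' c' s m t

theorem Simulates.trans {O O' O'' : Problem} (h : Simulates O'' O') (h' : Simulates O' O) :
    Simulates O'' O := by
  intro c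
  obtain ⟨c', K, hK⟩ := h' c
  obtain ⟨c'', K', hK'⟩ := h c'
  refine ⟨c'', K' * K, fun s n t hr => ?_⟩
  obtain ⟨m, hm, r⟩ := hK _ _ _ hr
  obtain ⟨m', hm', r'⟩ := hK' _ _ _ r
  exact ⟨m', hm'.trans (by rw [mul_assoc]; gcongr), r'⟩

/-! ### Stores given by lists of registers -/

theorem input_apply (l : List (List Bool)) (i : ℕ) : input l i = l.getD i [] := rfl

theorem input_of_length_le {l : List (List Bool)} {i : ℕ} (h : l.length ≤ i) : input l i = [] := by
  simp [input_apply, h]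

theorem input_append_left {l : List (List Bool)} {i : ℕ} (hi : i < l.length)
    (xs : List (List Bool)) : input (l ++ xs) i = input l i := by
  simp [input_apply, List.getElem?_append_left hi]

theorem input_append_right (l xs : List (List Bool)) (i : ℕ) :
    input (l ++ xs) (i + l.length) = input xs i := by
  simp only [input_apply, List.getD_eq_getElem?_getD]
  rw [List.getElem?_append_right (by omega), Nat.add_sub_cancel]

theorem input_map {α : Type*} {l : List α} {f : α → List Bool} {i : ℕ} (hi : i < l.length) :
    input (l.map f) i = f l[i] := by
  simp [input_apply, hi]

theorem update_input (l : List (List Bool)) {i : ℕ} (hi : i < l.length) (v : List Bool) :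
    update (input l) i v = input (l.set i v) := by
  funext j
  by_cases hj : j = i
  · subst hj; simp [input_apply, hi]
  · rw [update_of_ne hj]; simp [input_apply, List.getElem?_set_ne (Ne.symm hj)]

theorem update_input_length (l : List (List Bool)) {i : ℕ} (hi : l.length = i) (v : List Bool) :
    update (input l) i v = input (l ++ [v]) := by
  subst hi
  funext j
  rcases lt_trichotomy j l.length with h | h | h
  · rw [update_of_ne h.ne]; simp [input_apply, List.getElem?_append_left h]
  · subst h; simp [input_apply]
  · rw [update_of_ne h.ne', input_of_length_le h.le, input_of_length_le (by simpa using h)]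

theorem input_append_nil (l : List (List Bool)) : input (l ++ [[]]) = input l := by
  rw [← update_input_length l rfl []]
  conv_lhs => rw [← input_of_length_le (l := l) le_rfl]
  exact update_eq_self _ _

/-! ### Basic programs -/

/-- Empty stack `i`. -/
def clear (i : ℕ) : Prog := .loop i (.pop i)

theorem run_clear (O : Problem) (i : ℕ) (s : Store) :
    Run O (clear i) s (2 * (s i).length + 1) (update s i []) := by
  generalize hv : s i = v
  induction v generalizing s with
  | nil =>
    have : update s i [] = s := by rw [← hv]; simp
    rw [this]; exact .loop_done hv
  | cons b v ih =>
    have h1 := Run.pop (O := O) i s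
    have h2 := ih (update s i (s i).tail) (by simp [hv])
    rw [update_idem] at h2
    have := Run.loop_step (by simp [hv]) h1 h2
    refine (congrArg (fun n => Run O (clear i) s n (update s i [])) ?_).mp this
    simp; omega

/-- Move stack `i` to stack `j`, which reverses it. -/
def move (i j : ℕ) : Prog :=
  .loop i (.cond i .skip (.seq (.pop i) (.push j false)) (.seq (.pop i) (.push j true)))

theorem run_move (O : Problem) {i j : ℕ} (hij : i ≠ j) (s : Store) :
    Run O (move i j) s (4 * (s i).length + 1)
      (update (update s j ((s i).reverse ++ s j)) i []) := by
  generalize hv : s i = v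
  induction v generalizing s with
  | nil =>
    have : update s i [] = s := by rw [← hv]; simp
    simpa [this] using! Run.loop_done (O := O) hv
  | cons b v ih =>
    have h1 : Run O (.cond i .skip (.seq (.pop i) (.push j false)) (.seq (.pop i) (.push j true)))
        s (1 + 1 + 1) (update (update s i v) j (b :: s j)) := by
      have h2 : Run O (.seq (.pop i) (.push j b)) s (1 + 1)
          (update (update s i v) j (b :: s j)) := by
        have e1 := Run.pop (O := O) i s
        rw [hv] at e1
        have e2 := Run.push (O := O) j b (update s i v)
        rw [update_of_ne hij.symm] at e2
        exact .seq e1 e2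
      cases b
      · exact .cond_false (by simp [hv]) h2
      · exact .cond_true (by simp [hv]) h2
    have h3 := ih (update (update s i v) j (b :: s j)) (by rw [update_of_ne hij]; simp)
    have := Run.loop_step (by simp [hv]) h1 h3
    have e : update (update (update (update s i v) j (b :: s j)) j
        (v.reverse ++ (update (update s i v) j (b :: s j)) j)) i []
        = update (update s j ((b :: v).reverse ++ s j)) i [] := by
      funext k
      by_cases hk : k = i
      · simp [hk]
      · by_cases hk' : k = j
        · subst hk'; simp [hk]
        · simp [hk, hk']
    rw [e] at this
    refine (congrArg (fun n => Run O (move i j) s n _) ?_).mp this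
    simp; omega

/-- Move stack `i`, reversed, both to stack `j` and to stack `k`. -/
def moveBoth (i j k : ℕ) : Prog :=
  .loop i (.cond i .skip
    (.seq (.pop i) (.seq (.push j false) (.push k false)))
    (.seq (.pop i) (.seq (.push j true) (.push k true))))

theorem run_moveBoth (O : Problem) {i j k : ℕ} (hij : i ≠ j) (hik : i ≠ k) (hjk : j ≠ k)
    (s : Store) : Run O (moveBoth i j k) s (5 * (s i).length + 1)
      (update (update (update s j ((s i).reverse ++ s j)) k ((s i).reverse ++ s k)) i []) := by
  generalize hv : s i = v
  induction v generalizing s with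
  | nil =>
    have : update s i [] = s := by rw [← hv]; simp
    simpa [this] using! Run.loop_done (O := O) hv
  | cons b v ih =>
    set s' := update (update (update s i v) j (b :: s j)) k (b :: s k) with hs'
    have h2 : Run O (.seq (.pop i) (.seq (.push j b) (.push k b))) s (1 + (1 + 1)) s' := by
      have e1 := Run.pop (O := O) i s
      rw [hv] at e1
      have e2 := Run.push (O := O) j b (update s i v)
      rw [update_of_ne hij.symm] at e2
      have e3 := Run.push (O := O) k b (update (update s i v) j (b :: s j))
      rw [update_of_ne hjk.symm, update_of_ne hik.symm] at e3
      exact .seq e1 (.seq e2 e3)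
    have h1 : Run O (.cond i .skip
        (.seq (.pop i) (.seq (.push j false) (.push k false)))
        (.seq (.pop i) (.seq (.push j true) (.push k true)))) s (1 + (1 + 1) + 1) s' := by
      cases b
      · exact .cond_false (by simp [hv]) h2
      · exact .cond_true (by simp [hv]) h2
    have h3 := ih s' (by rw [hs', update_of_ne hik, update_of_ne hij]; simp)
    have := Run.loop_step (by simp [hv]) h1 h3
    have e : update (update (update s' j (v.reverse ++ s' j)) k (v.reverse ++ s' k)) i []
        = update (update (update s j ((b :: v).reverse ++ s j)) k ((b :: v).reverse ++ s k)) i []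
        := by
      funext x
      by_cases hx : x = i
      · simp [hx]
      · by_cases hx' : x = k
        · subst hx'; simp [hx, hs']
        · by_cases hx'' : x = j
          · subst hx''; simp [hx, hx', hs']
          · simp [hx, hx', hx'', hs']
    rw [e] at this
    refine (congrArg (fun n => Run O (moveBoth i j k) s n _) ?_).mp this
    simp; omega

/-- Put a copy of stack `i` on top of stack `j`, with the help of the empty stack `k`. -/
def copy (i j k : ℕ) : Prog := .seq (move i k) (moveBoth k i j)

/-- The two reversals cancel, and the auxiliary stack is empty again at the end. -/
theorem run_copy (O : Problem) {i j k : ℕ} (hij : i ≠ j) (hik : i ≠ k) (hjk : j ≠ k)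
    (s : Store) (hk : s k = []) :
    Run O (copy i j k) s (9 * (s i).length + 2) (update s j (s i ++ s j)) := by
  have h1 := run_move O hik s
  have h2 := run_moveBoth O hik.symm hjk.symm hij (update (update s k ((s i).reverse ++ s k)) i [])
  have := h1.seq h2
  have e : ∀ n n' t t', n = n' → t = t' → Run O (copy i j k) s n t →
    Run O (copy i j k) s n' t' := by rintro n _ t _ rfl rfl h; exact h
  refine e _ _ _ _ ?_ ?_ this
  · simp [hk, update_of_ne hik.symm]; omega
  · funext x
    by_cases hx : x = k
    · subst hx; simp [hk, hjk.symm]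
    · by_cases hx' : x = j
      · subst hx'; simp [hk, hx, hij.symm, hik.symm]
      · by_cases hx'' : x = i
        · subst hx''; simp [hk, hx, hx', hik.symm]
        · simp [hx, hx', hx'']

/-- Empty the stacks `k, …, k + n - 1`. -/
def clearRange (k : ℕ) : ℕ → Prog
  | 0 => .skip
  | n + 1 => .seq (clearRange k n) (clear (k + n))

theorem run_clearRange (O : Problem) (k n N : ℕ) (s : Store) (hs : ∀ i, (s i).length ≤ N) :
    ∃ m ≤ n * (2 * N + 1) + 1, Run O (clearRange k n) s m
      (fun i => if k ≤ i ∧ i < k + n then [] else s i) := by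
  induction n with
  | zero =>
    refine ⟨1, by omega, ?_⟩
    have : (fun i => if k ≤ i ∧ i < k + 0 then [] else s i) = s := by
      funext i; rw [if_neg (by omega)]
    rw [this]; exact .skip s
  | succ n ih =>
    obtain ⟨m, hm, hr⟩ := ih
    have h2 := run_clear O (k + n) (fun i => if k ≤ i ∧ i < k + n then [] else s i)
    refine ⟨m + (2 * (if k ≤ k + n ∧ k + n < k + n then [] else s (k + n)).length + 1), ?_, ?_⟩
    rotate_left
    · have := hr.seq h2
      have e : update (fun i => if k ≤ i ∧ i < k + n then [] else s i) (k + n) [] =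
          (fun i => if k ≤ i ∧ i < k + (n + 1) then [] else s i) := by
        funext i
        by_cases hi : i = k + n
        · subst hi; simp
        · rw [update_of_ne hi]
          exact if_congr (by omega) rfl rfl
      rw [e] at this
      exact this
    · have := hs (k + n)
      simp only [lt_irrefl, and_false, if_false]
      nlinarith

/-! ### Calling a program as a subroutine -/

/-- Copy the registers `args` to the registers from `k` on. -/
def load : ℕ → List ℕ → Prog
  | _, [] => .skip
  | k, a :: as => .seq (copy a k (k + 1)) (load (k + 1) as)

theorem run_load (O : Problem) (N : ℕ) (args : List ℕ) (l : List (List Bool))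
    (hargs : ∀ a ∈ args, a < l.length) (hN : ∀ i, (input l i).length ≤ N) :
    ∃ m ≤ args.length * (9 * N + 2) + 1, Run O (load l.length args) (input l) m
      (input (l ++ args.map (input l))) := by
  induction args generalizing l with
  | nil => exact ⟨1, by simp, by simpa using! Run.skip (O := O) (input l)⟩
  | cons a as ih =>
    have ha : a < l.length := hargs a (by simp)
    have h1 := run_copy O (i := a) (j := l.length) (k := l.length + 1) (by omega) (by omega)
      (by omega) (input l) (input_of_length_le (by omega))
    rw [input_of_length_le (l := l) le_rfl, List.append_nil, update_input_length l rfl] at h1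
    have key : ∀ i, i < l.length → input (l ++ [input l a]) i = input l i := by
      intro i hi; simp [input_apply, List.getElem?_append_left hi]
    obtain ⟨m, hm, hr⟩ := ih (l ++ [input l a])
      (fun b hb => by have := hargs b (by simp [hb]); simp; omega) (by
        intro i
        rw [← update_input_length l rfl]
        by_cases hi : i = l.length
        · subst hi; simpa using hN a
        · simpa [hi] using hN i)
    refine ⟨9 * (input l a).length + 2 + m, ?_, h1.seq ?_⟩
    · have := hN a
      simp only [List.length_cons]
      nlinarith
    · have e : (l ++ [input l a]) ++ as.map (input (l ++ [input l a])) =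
          l ++ (a :: as).map (input l) := by
        rw [List.append_assoc, List.map_cons, List.singleton_append]
        congr 2
        exact List.map_congr_left fun b hb => key b (hargs b (by simp [hb]))
      rw [e, List.length_append] at hr
      exact hr

/-- Run `c` on copies of the registers `args`; its first `keep` output registers are appended to the
`k` registers in use. -/
def call (k : ℕ) (args : List ℕ) (c : Prog) (keep : ℕ) : Prog :=
  .seq (load k args) (.seq (c.rename (· + k)) (clearRange (k + keep) (c.bound + args.length)))

theorem extend_add_input (l xs : List (List Bool)) :
    extend (· + l.length) (input xs) (input l) = input (l ++ xs) := by
  funext j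
  rcases lt_or_ge j l.length with h | h
  · rw [extend_apply' _ _ _ (by rintro ⟨i, rfl⟩; omega), input_append_left h]
  · obtain ⟨i, rfl⟩ := Nat.exists_eq_add_of_le' h
    rw [(add_left_injective l.length).extend_apply, input_append_right]

/-- The subroutine works above the `k` registers in use, which the frame rule protects. Erasing its
leftovers makes the result again a plain list of registers, so that calls can be chained. -/
theorem run_call {O : Problem} {N : ℕ} {args : List ℕ} {l : List (List Bool)} {k : ℕ}
    (hk : l.length = k) (hargs : ∀ a ∈ args, a < k) (hN : ∀ i, (input l i).length ≤ N) {c : Prog}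
    {n : ℕ} {t : Store} (hc : Run O c (input (args.map (input l))) n t) (keep : ℕ) :
    ∃ m ≤ args.length * (9 * N + 2) + n + (c.bound + args.length) * (2 * (N + n) + 1) + 2,
      Run O (call k args c keep) (input l) m (input (l ++ (List.range keep).map t)) := by
  subst hk
  obtain ⟨m1, hm1, h1⟩ := run_load O N args l hargs hN
  have h2 := hc.rename (add_left_injective l.length) (input l)
  rw [extend_add_input] at h2
  have hb : ∀ i, (extend (· + l.length) t (input l) i).length ≤ N + n := by
    intro i
    refine (h2.length_le i).trans (Nat.add_le_add_right ?_ _)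
    rw [← extend_add_input]
    by_cases hi : ∃ j, j + l.length = i
    · obtain ⟨j, rfl⟩ := hi
      rw [(add_left_injective l.length).extend_apply]
      rcases lt_or_ge j args.length with h | h
      · rw [input_map h]; exact hN _
      · rw [input_of_length_le (by simpa using h)]; exact Nat.zero_le _
    · rw [extend_apply' _ _ _ hi]; exact hN i
  obtain ⟨m3, hm3, h3⟩ := run_clearRange O (l.length + keep) (c.bound + args.length) (N + n) _ hb
  refine ⟨m1 + (n + m3), by omega, h1.seq (h2.seq ?_)⟩
  convert h3 using 1
  funext j
  rcases lt_or_ge j l.length with h | h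
  · rw [if_neg (by omega), extend_apply' _ _ _ (by rintro ⟨i, rfl⟩; omega), input_append_left h]
  · obtain ⟨i, rfl⟩ := Nat.exists_eq_add_of_le' h
    rw [(add_left_injective l.length).extend_apply]
    rcases lt_or_ge i keep with hi | hi
    · rw [if_neg (by omega)]
      rw [input_append_right, input_map (by simpa using hi), List.getElem_range]
    · have e1 : input (l ++ (List.range keep).map t) (i + l.length) = [] :=
        input_of_length_le (by simp; omega)
      rw [e1]
      split_ifs with h'
      · rfl
      -- Beyond the cleared range the index exceeds both `c.bound` and the number of arguments: the
      -- stack was empty and has not changed.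
      · rw [hc.eq_of_bound_le (by omega), input_of_length_le (by simp; omega)]

/-! ### Polynomial time bounds -/

theorem eval_mono (p : Polynomial ℕ) {m n : ℕ} (h : m ≤ n) : p.eval m ≤ p.eval n := by
  rw [Polynomial.eval_eq_sum_range, Polynomial.eval_eq_sum_range]
  gcongr

variable {ι κ : Type} {O : Problem} {D : ι → Prop}

/-- On the inputs `s g` with `D g`, the program `c` halts with a result in `Q g`, in time polynomial
in the maximum length of a stack. -/
def PolyRun (O : Problem) (c : Prog) (D : ι → Prop) (s : ι → Store) (Q : ι → Store → Prop) : Prop :=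
  ∃ q : Polynomial ℕ, ∀ g, D g → ∀ N, (∀ i, (s g i).length ≤ N) →
    ∃ m ≤ q.eval N, ∃ t, Run O c (s g) m t ∧ Q g t

/-- In polynomial time, the program `c` transforms the registers `l g` into `l' g`. -/
def PolyStep (O : Problem) (c : Prog) (D : ι → Prop) (l l' : ι → List (List Bool)) : Prop :=
  PolyRun O c D (fun g => input (l g)) (fun g t => t = input (l' g))

theorem PolyRun.mono {c : Prog} {s : ι → Store} {D' : ι → Prop} {Q Q' : ι → Store → Prop}
    (h : PolyRun O c D s Q) (hD : ∀ g, D' g → D g)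
    (hQ : ∀ g t, D' g → Q g t → Q' g t) : PolyRun O c D' s Q' := by
  obtain ⟨q, hq⟩ := h
  refine ⟨q, fun g hg N hN => ?_⟩
  obtain ⟨m, hm, t, hr, ht⟩ := hq g (hD g hg) N hN
  exact ⟨m, hm, t, hr, hQ g t hg ht⟩

theorem PolyRun.reindex {c : Prog} {s : ι → Store} {Q : ι → Store → Prop}
    (h : PolyRun O c D s Q) (f : κ → ι) :
    PolyRun O c (fun k => D (f k)) (fun k => s (f k)) (fun k => Q (f k)) := by
  obtain ⟨q, hq⟩ := h
  exact ⟨q, fun g hg N hN => hq (f g) hg N hN⟩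

theorem PolyRun.simulate {O' : Problem} {c : Prog} {s : ι → Store} {Q : ι → Store → Prop}
    (h : PolyRun O c D s Q) (hO : Simulates O' O) : ∃ c', PolyRun O' c' D s Q := by
  obtain ⟨q, hq⟩ := h
  obtain ⟨c', K, hK⟩ := hO c
  refine ⟨c', Polynomial.C K * q, fun g hg N hN => ?_⟩
  obtain ⟨m, hm, t, hr, ht⟩ := hq g hg N hN
  obtain ⟨m', hm', hr'⟩ := hK _ _ _ hr
  refine ⟨m', hm'.trans ?_, t, hr', ht⟩
  simp only [Polynomial.eval_mul, Polynomial.eval_C]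
  gcongr

/-- The second program may start on longer stacks, but after `q.eval N` steps no stack is longer
than `N + q.eval N`. -/
theorem PolyStep.seq {c d : Prog} {l l' : ι → List (List Bool)} {Q : ι → Store → Prop}
    (h1 : PolyStep O c D l l') (h2 : PolyRun O d D (fun g => input (l' g)) Q) :
    PolyRun O (.seq c d) D (fun g => input (l g)) Q := by
  obtain ⟨q, hq⟩ := h1
  obtain ⟨r, hr⟩ := h2
  refine ⟨q + r.comp (Polynomial.X + q), fun g hg N hN => ?_⟩
  obtain ⟨m, hm, t, h1, rfl⟩ := hq g hg N hN
  obtain ⟨m', hm', u, h2, hu⟩ := hr g hg (N + q.eval N)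
    fun i => (h1.length_le i).trans (Nat.add_le_add (hN i) hm)
  refine ⟨m + m', ?_, u, h1.seq h2, hu⟩
  simp only [Polynomial.eval_add, Polynomial.eval_comp, Polynomial.eval_X]
  omega

theorem PolyRun.cond {c d e : Prog} {i : ℕ} {s : ι → Store} {Q : ι → Store → Prop}
    (h0 : PolyRun O c (fun g => D g ∧ s g i = []) s Q)
    (h1 : PolyRun O d (fun g => D g ∧ (s g i).head? = some false) s Q)
    (h2 : PolyRun O e (fun g => D g ∧ (s g i).head? = some true) s Q) :
    PolyRun O (.cond i c d e) D s Q := by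
  obtain ⟨q0, h0⟩ := h0
  obtain ⟨q1, h1⟩ := h1
  obtain ⟨q2, h2⟩ := h2
  refine ⟨q0 + q1 + q2 + 1, fun g hg N hN => ?_⟩
  simp only [Polynomial.eval_add, Polynomial.eval_one]
  rcases hv : (s g i).head? with _ | _ | _
  · have hv : s g i = [] := by simpa using hv
    obtain ⟨m, hm, t, hr, ht⟩ := h0 g ⟨hg, hv⟩ N hN
    exact ⟨m + 1, by omega, t, hr.cond_nil hv, ht⟩
  · obtain ⟨m, hm, t, hr, ht⟩ := h1 g ⟨hg, hv⟩ N hN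
    exact ⟨m + 1, by omega, t, hr.cond_false hv, ht⟩
  · obtain ⟨m, hm, t, hr, ht⟩ := h2 g ⟨hg, hv⟩ N hN
    exact ⟨m + 1, by omega, t, hr.cond_true hv, ht⟩

theorem PolyStep.of_run {c : Prog} {l l' : ι → List (List Bool)} (a : ℕ)
    (h : ∀ g, D g → ∀ N, (∀ i, (input (l g) i).length ≤ N) →
      ∃ m ≤ a * N + a, Run O c (input (l g)) m (input (l' g))) : PolyStep O c D l l' := by
  refine ⟨Polynomial.C a * Polynomial.X + Polynomial.C a, fun g hg N hN => ?_⟩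
  obtain ⟨m, hm, hr⟩ := h g hg N hN
  exact ⟨m, by simpa using hm, _, hr, rfl⟩

theorem PolyStep.skip {l : ι → List (List Bool)} : PolyStep O .skip D l l :=
  .of_run 1 fun _ _ _ _ => ⟨1, by omega, .skip _⟩

theorem PolyStep.push {l : ι → List (List Bool)} {i : ℕ} {b : Bool}
    (h : ∀ g, D g → i < (l g).length) :
    PolyStep O (.push i b) D l (fun g => (l g).set i (b :: input (l g) i)) := by
  refine .of_run 1 fun g hg N _ => ⟨1, by omega, ?_⟩
  rw [← update_input _ (h g hg)]
  exact .push _ _ _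

theorem PolyStep.pop {l : ι → List (List Bool)} {i : ℕ} (h : ∀ g, D g → i < (l g).length) :
    PolyStep O (.pop i) D l (fun g => (l g).set i (input (l g) i).tail) := by
  refine .of_run 1 fun g hg N _ => ⟨1, by omega, ?_⟩
  rw [← update_input _ (h g hg)]
  exact .pop _ _

theorem PolyStep.clear {l : ι → List (List Bool)} {i : ℕ} (h : ∀ g, D g → i < (l g).length) :
    PolyStep O (clear i) D l (fun g => (l g).set i []) := by
  refine .of_run 2 fun g hg N hN => ⟨2 * (input (l g) i).length + 1, ?_, ?_⟩
  · have := hN i; omega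
  · rw [← update_input _ (h g hg)]
    exact run_clear _ _ _

theorem PolyStep.move {l : ι → List (List Bool)} {i j : ℕ} (hij : i ≠ j)
    (hi : ∀ g, D g → i < (l g).length) (hj : ∀ g, D g → j < (l g).length) :
    PolyStep O (move i j) D l
      (fun g => ((l g).set j ((input (l g) i).reverse ++ input (l g) j)).set i []) := by
  refine .of_run 4 fun g hg N hN => ⟨4 * (input (l g) i).length + 1, ?_, ?_⟩
  · have := hN i; omega
  · rw [← update_input _ (by simpa using hi g hg), ← update_input _ (hj g hg)]
    exact run_move _ hij _

theorem PolyStep.congr {c : Prog} {l l' m m' : ι → List (List Bool)} (h : PolyStep O c D l l')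
    (hl : ∀ g, D g → input (l g) = input (m g)) (hl' : ∀ g, D g → input (l' g) = input (m' g)) :
    PolyStep O c D m m' := by
  obtain ⟨q, hq⟩ := h
  refine ⟨q, fun g hg N hN => ?_⟩
  obtain ⟨n, hn, t, hr, rfl⟩ := hq g hg N (by simpa only [hl g hg] using hN)
  exact ⟨n, hn, _, by simpa only [hl g hg] using hr, hl' g hg⟩

theorem PolyRun.call {c : Prog} {l : ι → List (List Bool)} {k : ℕ} {args : List ℕ}
    {out : ι → Store} (keep : ℕ) (hl : ∀ g, D g → (l g).length = k) (hargs : ∀ a ∈ args, a < k)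
    (h : PolyRun O c D (fun g => input (args.map (input (l g)))) (fun g t => t = out g)) :
    PolyStep O (call k args c keep) D l (fun g => l g ++ (List.range keep).map (out g)) := by
  obtain ⟨q, hq⟩ := h
  refine ⟨Polynomial.C args.length * (9 * Polynomial.X + 2) + q +
    Polynomial.C (c.bound + args.length) * (2 * (Polynomial.X + q) + 1) + 2,
    fun g hg N hN => ?_⟩
  obtain ⟨n, hn, t, hr, rfl⟩ := hq g hg N (fun i => by
    beta_reduce
    rcases lt_or_ge i args.length with h | h
    · rw [input_map h]; exact hN _
    · rw [input_of_length_le (by simpa using h)]; exact Nat.zero_le _)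
  obtain ⟨m, hm, hr'⟩ := run_call (hl g hg) hargs hN hr keep
  refine ⟨m, hm.trans ?_, _, hr', rfl⟩
  simp only [Polynomial.eval_add, Polynomial.eval_mul, Polynomial.eval_C, Polynomial.eval_X,
    Polynomial.eval_ofNat, Polynomial.eval_one]
  gcongr

theorem exists_length_le (l : List (List Bool)) : ∃ N, ∀ i, (input l i).length ≤ N := by
  refine ⟨(l.map List.length).sum, fun i => ?_⟩
  rcases lt_or_ge i l.length with h | h
  · have : input l i = l[i] := by simp [input_apply, h]
    rw [this]
    exact List.single_le_sum (by simp) _ (List.mem_map_of_mem (List.getElem_mem h))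
  · rw [input_of_length_le h]; exact Nat.zero_le _

/-- The result of a run is a function of the input. -/
theorem PolyRun.exists_fun {c : Prog} {l : ι → List (List Bool)} {Q : ι → Store → Prop}
    (h : PolyRun O c D (fun g => input (l g)) Q) :
    ∃ out : ι → Store, PolyRun O c D (fun g => input (l g)) (fun g t => t = out g) ∧
      ∀ g, D g → Q g (out g) := by
  obtain ⟨q, hq⟩ := h
  have h1 : ∀ g, ∃ t, D g → (∃ m, Run O c (input (l g)) m t) ∧ Q g t := by
    intro g
    by_cases hg : D g
    · obtain ⟨N, hN⟩ := exists_length_le (l g)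
      obtain ⟨m, -, t, hr, ht⟩ := hq g hg N hN
      exact ⟨t, fun _ => ⟨⟨m, hr⟩, ht⟩⟩
    -- Outside `D` nothing is known about halting, and the value is arbitrary.
    · exact ⟨input [], fun h => absurd h hg⟩
  choose out hout using h1
  refine ⟨out, ⟨q, fun g hg N hN => ?_⟩, fun g hg => (hout g hg).2⟩
  obtain ⟨m, hm, t, hr, -⟩ := hq g hg N hN
  obtain ⟨⟨m', hr'⟩, -⟩ := hout g hg
  exact ⟨m, hm, t, hr, (hr.unique hr').2⟩

/-- A loop whose body keeps an invariant and shortens the stack that controls the loop. -/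
theorem run_loop {c : Prog} {i T : ℕ} (Inv : Store → Prop)
    (hc : ∀ s, Inv s → s i ≠ [] →
      ∃ m ≤ T, ∃ t, Run O c s m t ∧ Inv t ∧ (t i).length < (s i).length) (s : Store) (hs : Inv s) :
    ∃ m ≤ (s i).length * (T + 1) + 1, ∃ t, Run O (.loop i c) s m t ∧ Inv t ∧ t i = [] := by
  induction hn : (s i).length using Nat.strong_induction_on generalizing s with
  | _ n ih =>
    by_cases h0 : s i = []
    · exact ⟨1, by omega, s, .loop_done h0, hs, h0⟩
    · obtain ⟨m, hm, t, hr, ht, hlt⟩ := hc s hs h0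
      obtain ⟨m', hm', u, hr', hu⟩ := ih _ (by omega) t ht rfl
      refine ⟨m + m' + 1, ?_, u, .loop_step h0 hr hr', hu⟩
      have : ((t i).length + 1) * (T + 1) ≤ n * (T + 1) := by gcongr; omega
      rw [add_mul] at this
      omega

/-! ### Binary decision procedures -/

/-- `c` decides the binary relation `p` in polynomial time. -/
def Decides (O : Problem) (c : Prog) (p : List Bool → List Bool → Prop) : Prop :=
  PolyRun O c (fun _ => True) (fun g : List Bool × List Bool => input [g.1, g.2])
    (fun g t => (t 0).head? = some true ↔ p g.1 g.2)

theorem length_input_pair_le (x y : List Bool) (i : ℕ) :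
    (input [x, y] i).length ≤ x.length + y.length := by
  rcases i with _ | _ | i <;> simp [input_apply]

theorem decides_of_accepts {c : Prog} {p : List Bool → List Bool → Prop} (q : Polynomial ℕ)
    (hh : ∀ x y, HaltsWithin O c [x, y] (q.eval (x.length + y.length)))
    (ha : ∀ x y, Accepts O c [x, y] ↔ p x y) : Decides O c p := by
  refine ⟨q.comp (2 * Polynomial.X), fun g _ N hN => ?_⟩
  obtain ⟨m, hm, s, hr⟩ := hh g.1 g.2
  have h0 := hN 0
  have h1 := hN 1
  simp only [input_apply, List.getD_cons_zero, List.getD_cons_succ] at h0 h1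
  refine ⟨m, hm.trans ?_, s, hr, ?_⟩
  · simp only [Polynomial.eval_comp, Polynomial.eval_mul, Polynomial.eval_ofNat,
      Polynomial.eval_X]
    exact eval_mono _ (by omega)
  · beta_reduce
    rw [← ha]
    refine ⟨fun h => ⟨m, s, hr, h⟩, ?_⟩
    rintro ⟨m', s', hr', h⟩
    rwa [(hr.unique hr').2]

theorem Decides.accepts {c : Prog} {p : List Bool → List Bool → Prop} (h : Decides O c p) :
    ∃ q : Polynomial ℕ, (∀ x y, HaltsWithin O c [x, y] (q.eval (x.length + y.length))) ∧
      ∀ x y, Accepts O c [x, y] ↔ p x y := by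
  obtain ⟨q, hq⟩ := h
  refine ⟨q, fun x y => ?_, fun x y => ?_⟩ <;>
    obtain ⟨m, hm, t, hr, ht⟩ := hq (x, y) trivial _ (length_input_pair_le x y)
  · exact ⟨m, hm, t, hr⟩
  · rw [← ht]
    refine ⟨?_, fun h => ⟨m, t, hr, h⟩⟩
    rintro ⟨m', s', hr', h⟩
    rwa [(hr.unique hr').2]

/-- The first program is called on copies, so both arguments survive. Its verdict on stack 2 is
erased because `d` expects all stacks but the arguments to be empty. -/
theorem Decides.and {c d : Prog} {p q : List Bool → List Bool → Prop} (hc : Decides O c p)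
    (hd : Decides O d q) : ∃ e, Decides O e (fun x y => p x y ∧ q x y) := by
  obtain ⟨out, hc, hout⟩ := PolyRun.exists_fun (l := fun g : List Bool × List Bool => [g.1, g.2]) hc
  refine ⟨.seq (call 2 [0, 1] c 1) (.cond 2 (.push 0 false) (.push 0 false) (.seq (clear 2) d)), ?_⟩
  have h1 : PolyStep O (call 2 [0, 1] c 1) (fun _ => True)
      (fun g : List Bool × List Bool => [g.1, g.2]) (fun g => [g.1, g.2, out g 0]) :=
    PolyRun.call 1 (by simp) (by simp) hc
  have hrej : ∀ D' : List Bool × List Bool → Prop, (∀ g, D' g → ¬ p g.1 g.2) →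
      PolyRun O (.push 0 false) D' (fun g => input [g.1, g.2, out g 0])
        (fun g t => (t 0).head? = some true ↔ p g.1 g.2 ∧ q g.1 g.2) := by
    intro D' hD'
    refine (PolyStep.push (by simp)).mono (fun _ h => h) ?_
    rintro g t hg rfl
    simp [input_apply, hD' g hg]
  refine h1.seq (.cond (hrej _ ?_) (hrej _ ?_) ?_)
  · rintro g ⟨-, h⟩
    rw [← hout g trivial]
    have h : out g 0 = [] := h
    simp [h]
  · rintro g ⟨-, h⟩
    rw [← hout g trivial]
    have h : (out g 0).head? = some false := h
    simp [h]
  · have h2 : PolyStep O (clear 2)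
        (fun g => True ∧ (input [g.1, g.2, out g 0] 2).head? = some true)
        (fun g : List Bool × List Bool => [g.1, g.2, out g 0]) (fun g => [g.1, g.2]) :=
      (PolyStep.clear (by simp)).congr (fun _ _ => rfl) (fun g _ => input_append_nil [g.1, g.2])
    refine h2.seq (hd.mono (fun _ _ => trivial) ?_)
    rintro g t ⟨-, h⟩ ht
    rw [ht]
    have : p g.1 g.2 := (hout g trivial).1 h
    simp [this]

/-- A program for inequality of strings. -/
theorem exists_decides_ne (O : Problem) : ∃ c, Decides O c (fun x y => x ≠ y) := by
  -- Stacks 0 and 1 are popped in parallel, and stack 2 becomes non-empty at the first mismatch.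
  -- After the loop, a non-empty stack 1 also means inequality.
  let body : Prog := .cond 0 .skip
    (.seq (.pop 0) (.cond 1 (.push 2 true) (.pop 1) (.push 2 true)))
    (.seq (.pop 0) (.cond 1 (.push 2 true) (.push 2 true) (.pop 1)))
  refine ⟨.seq (.loop 0 body) (.cond 2 (.cond 1 .skip (.push 0 true) (.push 0 true))
    (.push 0 true) (.push 0 true)), 5 * Polynomial.X + 5, ?_⟩
  rintro ⟨x, y⟩ - N hN
  have hx : x.length ≤ N := hN 0
  have hbody : ∀ b u v f, ∃ v' f', Run O body (input [b :: u, v, f]) (1 + (1 + 1) + 1)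
      (input [u, v', f']) ∧ (f = [] ∧ b :: u = v ↔ f' = [] ∧ u = v') := by
    intro b u v f
    have hpop : Run O (.pop 0) (input [b :: u, v, f]) 1 (input [u, v, f]) := by
      have := Run.pop (O := O) 0 (input [b :: u, v, f])
      rwa [update_input _ (by simp)] at this
    have hpush : ∀ w, Run O (.push 2 true) (input [u, w, f]) 1 (input [u, w, true :: f]) := by
      intro w
      have := Run.push (O := O) 2 true (input [u, w, f])
      rwa [update_input _ (by simp)] at this
    have hpop' : ∀ d w, Run O (.pop 1) (input [u, d :: w, f]) 1 (input [u, w, f]) := by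
      intro d w
      have := Run.pop (O := O) 1 (input [u, d :: w, f])
      rwa [update_input _ (by simp)] at this
    rcases v with _ | ⟨d, v⟩
    · refine ⟨[], true :: f, ?_, by simp⟩
      cases b
      · exact .cond_false rfl (hpop.seq (.cond_nil rfl (hpush _)))
      · exact .cond_true rfl (hpop.seq (.cond_nil rfl (hpush _)))
    · cases b <;> cases d
      · exact ⟨v, f, .cond_false rfl (hpop.seq (.cond_false rfl (hpop' _ _))), by simp⟩
      · exact ⟨_, _, .cond_false rfl (hpop.seq (.cond_true rfl (hpush _))), by simp⟩
      · exact ⟨_, _, .cond_true rfl (hpop.seq (.cond_false rfl (hpush _))), by simp⟩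
      · exact ⟨v, f, .cond_true rfl (hpop.seq (.cond_true rfl (hpop' _ _))), by simp⟩
  obtain ⟨m, hm, t, hr, ⟨u, v, f, rfl, ht⟩, h0⟩ := run_loop (O := O) (c := body) (i := 0) (T := 4)
    (fun s => ∃ u v f, s = input [u, v, f] ∧ (x = y ↔ f = [] ∧ u = v)) (by
      rintro _ ⟨u, v, f, rfl, h⟩ h0
      rcases u with _ | ⟨b, u⟩
      · exact absurd rfl h0
      · obtain ⟨v', f', hr, hf⟩ := hbody b u v f
        exact ⟨_, le_rfl, _, hr, ⟨u, v', f', rfl, h.trans hf⟩, by simp [input_apply]⟩)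
    (input [x, y]) ⟨x, y, [], (input_append_nil [x, y]).symm, by simp⟩
  have hu : u = [] := h0
  subst hu
  have hpush : Run O (.push 0 true) (input [[], v, f]) 1 (input [[true], v, f]) := by
    have := Run.push (O := O) 0 true (input [[], v, f])
    rwa [update_input _ (by simp)] at this
  have hm : m ≤ 5 * N + 1 := hm.trans (by simp only [input_apply, List.getD_cons_zero]; omega)
  simp only [Polynomial.eval_add, Polynomial.eval_mul, Polynomial.eval_X, Polynomial.eval_ofNat]
  rcases f with _ | ⟨b, f⟩
  · rcases v with _ | ⟨b, v⟩
    · exact ⟨m + (1 + 1 + 1), by omega, _, hr.seq (.cond_nil rfl (.cond_nil rfl (.skip _))), by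
        simp [input_apply, ht]⟩
    · refine ⟨m + (1 + 1 + 1), by omega, input [[true], b :: v, []], hr.seq (.cond_nil rfl ?_), by
        simp [input_apply, ht]⟩
      cases b
      · exact .cond_false rfl hpush
      · exact .cond_true rfl hpush
  · refine ⟨m + (1 + 1), by omega, input [[true], v, b :: f], hr.seq ?_, by
        simp [input_apply, ht]⟩
    cases b
    · exact .cond_false rfl hpush
    · exact .cond_true rfl hpush

/-! ### Scanning an encoded list -/

theorem encodeList_cons (x : List Bool) (xs : List (List Bool)) :
    encodeList (x :: xs) = (x.flatMap fun b => [true, b]) ++ false :: encodeList xs := by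
  simp [encodeList]

/-- Entries are self-delimiting: the first `false` in a marker position ends the first entry. -/
theorem flatMap_append_false_eq_encodeList {y r : List Bool} {xs : List (List Bool)}
    (h : (y.flatMap fun b => [true, b]) ++ false :: r = encodeList xs) :
    ∃ xs', xs = y :: xs' ∧ r = encodeList xs' := by
  induction y generalizing xs with
  | nil =>
    rcases xs with _ | ⟨_ | ⟨b, x⟩, xs⟩
    · simp [encodeList] at h
    · exact ⟨xs, rfl, by simpa [encodeList_cons] using h⟩
    · simp [encodeList_cons] at h
  | cons a y ih =>
    rcases xs with _ | ⟨_ | ⟨b, x⟩, xs⟩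
    · simp [encodeList] at h
    · simp [encodeList_cons] at h
    · have h' : a = b ∧ (y.flatMap fun b => [true, b]) ++ false :: r = encodeList (x :: xs) := by
        simpa [encodeList_cons] using h
      obtain ⟨xs', hx, hr⟩ := ih h'.2
      obtain ⟨rfl, rfl⟩ := List.cons_eq_cons.mp hx
      exact ⟨xs, by rw [h'.1], hr⟩

/-- The two ways in which a scan can end badly: inside an entry whose closing `false` is missing, or
after a marker `true` without its bit. -/
theorem flatMap_append_ne_encodeList {y r : List Bool} (hr : r = [] ∧ y ≠ [] ∨ r = [true])
    (xs : List (List Bool)) : (y.flatMap fun b => [true, b]) ++ r ≠ encodeList xs := by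
  induction y generalizing xs with
  | nil =>
    rcases xs with _ | ⟨_ | ⟨b, x⟩, xs⟩ <;> rcases hr with hr | hr <;>
      simp_all [encodeList]
  | cons a y ih =>
    rcases xs with _ | ⟨_ | ⟨b, x⟩, xs⟩
    · simp [encodeList]
    · simp [encodeList_cons]
    · intro h
      have h' : a = b ∧ (y.flatMap fun b => [true, b]) ++ r = encodeList (x :: xs) := by
        simpa [encodeList_cons] using h
      by_cases hy : y = [] ∧ r = []
      · obtain ⟨rfl, rfl⟩ := hy
        rcases x with _ | ⟨_, _⟩ <;> simp [encodeList_cons] at h'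
      · exact ih (by tauto) _ h'.2

theorem encodeList_injective : Injective encodeList := by
  intro xs ys h
  induction xs generalizing ys with
  | nil =>
    rcases ys with _ | ⟨_ | ⟨b, y⟩, ys⟩
    · rfl
    · simp [encodeList] at h
    · simp [encodeList] at h
  | cons x xs ih =>
    rw [encodeList_cons] at h
    obtain ⟨ys', rfl, h'⟩ := flatMap_append_false_eq_encodeList h
    rw [ih h']

theorem length_flatMap_true (x : List Bool) :
    (x.flatMap fun b => [true, b]).length = 2 * x.length := by
  induction x with
  | nil => rfl
  | cons b x ih => simp only [List.flatMap_cons, List.length_append, ih]; simp; omega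

theorem length_encodeList_le {xs : List (List Bool)} {m : ℕ} (h : ∀ x ∈ xs, x.length ≤ m) :
    (encodeList xs).length ≤ xs.length * (2 * m + 1) := by
  induction xs with
  | nil => simp [encodeList]
  | cons x xs ih =>
    have h1 := ih fun y hy => h y (by simp [hy])
    have h2 := h x (by simp)
    rw [encodeList_cons, List.length_append, length_flatMap_true]
    simp only [List.length_cons]
    linarith

/-- `tmp` reversed, followed by what remains to be read in `rem`, encodes a list of strings with the
property `p`. -/
def scan (p : List Bool → Prop) : List Bool → List Bool → Prop
  | tmp, [] => tmp = []
  | tmp, false :: rem => p tmp.reverse ∧ scan p [] rem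
  | _, [true] => False
  | tmp, true :: b :: rem => scan p (b :: tmp) rem

theorem scan_iff (p : List Bool → Prop) (tmp rem : List Bool) :
    scan p tmp rem ↔ ∃ xs, (tmp.reverse.flatMap fun b => [true, b]) ++ rem = encodeList xs ∧
      ∀ x ∈ xs, p x := by
  fun_induction scan p tmp rem with
  | case1 tmp =>
    constructor
    · rintro rfl; exact ⟨[], by simp [encodeList], by simp⟩
    · rintro ⟨xs, h, -⟩
      by_contra hne
      exact flatMap_append_ne_encodeList (.inl ⟨rfl, by simpa using hne⟩) _ h
  | case2 tmp rem ih =>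
    rw [ih]
    constructor
    · rintro ⟨hp, xs, h, hxs⟩
      refine ⟨tmp.reverse :: xs, ?_, by simpa using ⟨hp, hxs⟩⟩
      rw [encodeList_cons, ← h]; simp
    · rintro ⟨xs, h, hxs⟩
      obtain ⟨xs', rfl, h'⟩ := flatMap_append_false_eq_encodeList h
      exact ⟨hxs _ (by simp), xs', by simpa using h', fun x hx => hxs x (by simp [hx])⟩
  | case3 tmp =>
    refine iff_of_false id ?_
    rintro ⟨xs, h, -⟩
    exact flatMap_append_ne_encodeList (.inr rfl) _ h
  | case4 tmp b rem ih =>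
    rw [ih]
    simp

theorem PolyStep.call_pair {O : Problem} {d : Prog} {ι : Type} {D : ι → Prop}
    {out : List Bool × List Bool → Store}
    (hd : PolyRun O d (fun _ => True) (fun g : List Bool × List Bool => input [g.1, g.2])
      (fun g t => t = out g)) {k a b : ℕ} {l : ι → List (List Bool)}
    (hl : ∀ g, D g → (l g).length = k) (ha : a < k) (hb : b < k) :
    PolyStep O (call k [a, b] d 1) D l
      (fun g => l g ++ [out (input (l g) a, input (l g) b) 0]) :=
  PolyRun.call 1 hl (by simp [ha, hb])
    ((hd.reindex fun g => (input (l g) a, input (l g) b)).mono (fun _ _ => trivial)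
      fun _ _ _ h => h)

/-- A program that decides whether a string encodes a list all of whose entries stand in a decidable
relation to the second argument. -/
theorem Decides.forall_mem {O : Problem} {d : Prog} {p : List Bool → List Bool → Prop}
    (hd : Decides O d p) :
    ∃ c, Decides O c (fun w z => ∃ xs, w = encodeList xs ∧ ∀ x ∈ xs, p x z) := by
  obtain ⟨out, hd, hout⟩ := PolyRun.exists_fun (l := fun g : List Bool × List Bool => [g.1, g.2]) hd
  -- Registers: 0 the unread input, 1 the second argument, 2 the current entry reversed, 3 a failure
  -- flag (empty means no failure), 4 the entry in its right order, 5 the verdict of `d`.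
  let atEnd : Prog := .seq (.pop 0) (.seq (move 2 4) (.seq (call 5 [4, 1] d 1)
    (.seq (clear 4) (.cond 5 (.push 3 true) (.push 3 true) (clear 5)))))
  let atEnd' : Prog := .seq atEnd (clear 5)
  let atBit : Prog := .seq (.pop 0) (.cond 0 (.push 3 true) (.seq (.pop 0) (.push 2 false))
    (.seq (.pop 0) (.push 2 true)))
  let body : Prog := .cond 0 .skip atEnd' atBit
  have hbody : PolyRun O body (fun g => g.1 ≠ [])
      (fun g : List Bool × List Bool × List Bool × List Bool =>
        input [g.1, g.2.1, g.2.2.1, g.2.2.2])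
      (fun g t => ∃ rem tmp bad, t = input [rem, g.2.1, tmp, bad] ∧ rem.length < g.1.length ∧
        -- The total length does not grow, so one bound on the cost of the body holds throughout the
        -- loop.
        rem.length + tmp.length + bad.length ≤ g.1.length + g.2.2.1.length + g.2.2.2.length ∧
        (g.2.2.2 = [] ∧ scan (p · g.2.1) g.2.2.1 g.1 ↔ bad = [] ∧ scan (p · g.2.1) tmp rem)) := by
    refine .cond ?_ ?_ ?_
    · exact PolyStep.skip.mono (fun _ h => h) fun g t h => absurd h.2 h.1
    · set D : List Bool × List Bool × List Bool × List Bool → Prop :=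
        fun g => g.1 ≠ [] ∧ (input [g.1, g.2.1, g.2.2.1, g.2.2.2] 0).head? = some false
      have h1 : PolyStep O (.pop 0) D (fun g => [g.1, g.2.1, g.2.2.1, g.2.2.2])
          (fun g => [g.1.tail, g.2.1, g.2.2.1, g.2.2.2]) := .pop (by simp)
      have h2 : PolyStep O (move 2 4) D (fun g => [g.1.tail, g.2.1, g.2.2.1, g.2.2.2])
          (fun g => [g.1.tail, g.2.1, [], g.2.2.2, g.2.2.1.reverse]) := by
        have h := PolyStep.move (O := O) (D := D) (i := 2) (j := 4)
          (l := fun g => [g.1.tail, g.2.1, g.2.2.1, g.2.2.2, []]) (by simp) (by simp) (by simp)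
        refine h.congr (fun g _ => input_append_nil [g.1.tail, g.2.1, g.2.2.1, g.2.2.2])
          (fun g _ => ?_)
        simp [input_apply]
      have h3 : PolyStep O (call 5 [4, 1] d 1) D
          (fun g => [g.1.tail, g.2.1, [], g.2.2.2, g.2.2.1.reverse])
          (fun g => [g.1.tail, g.2.1, [], g.2.2.2, g.2.2.1.reverse,
            out (g.2.2.1.reverse, g.2.1) 0]) :=
        .call_pair hd (by simp) (by simp) (by simp)
      have h4 : PolyStep O (clear 4) D
          (fun g => [g.1.tail, g.2.1, [], g.2.2.2, g.2.2.1.reverse,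
            out (g.2.2.1.reverse, g.2.1) 0])
          (fun g => [g.1.tail, g.2.1, [], g.2.2.2, [], out (g.2.2.1.reverse, g.2.1) 0]) :=
        .clear (by simp)
      let bad' : List Bool × List Bool × List Bool × List Bool → List Bool := fun g =>
        if (out (g.2.2.1.reverse, g.2.1) 0).head? = some true then g.2.2.2 else true :: g.2.2.2
      let res' : List Bool × List Bool × List Bool × List Bool → List Bool := fun g =>
        if (out (g.2.2.1.reverse, g.2.1) 0).head? = some true then []
        else out (g.2.2.1.reverse, g.2.1) 0
      have h5 : PolyStep O (.cond 5 (.push 3 true) (.push 3 true) (clear 5)) D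
          (fun g => [g.1.tail, g.2.1, [], g.2.2.2, [], out (g.2.2.1.reverse, g.2.1) 0])
          (fun g => [g.1.tail, g.2.1, [], bad' g, [], res' g]) := by
        refine .cond ?_ ?_ ?_
        · refine (PolyStep.push (by simp)).congr (fun _ _ => rfl) ?_
          rintro g ⟨-, h⟩
          have h : out (g.2.2.1.reverse, g.2.1) 0 = [] := h
          simp [bad', res', h, input_apply]
        · refine (PolyStep.push (by simp)).congr (fun _ _ => rfl) ?_
          rintro g ⟨-, h⟩
          have h : (out (g.2.2.1.reverse, g.2.1) 0).head? = some false := h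
          simp [bad', res', h, input_apply]
        · refine (PolyStep.clear (by simp)).congr (fun _ _ => rfl) ?_
          rintro g ⟨-, h⟩
          have h : (out (g.2.2.1.reverse, g.2.1) 0).head? = some true := h
          simp [bad', res', h]
      have h6 : PolyStep O (clear 5) D (fun g => [g.1.tail, g.2.1, [], bad' g, [], res' g])
          (fun g => [g.1.tail, g.2.1, [], bad' g]) := by
        refine (PolyStep.clear (by simp)).congr (fun _ _ => rfl) (fun g _ => ?_)
        exact (input_append_nil [g.1.tail, g.2.1, [], bad' g, []]).trans
          (input_append_nil [g.1.tail, g.2.1, [], bad' g])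
      have h7 : PolyStep O atEnd D (fun g => [g.1, g.2.1, g.2.2.1, g.2.2.2])
          (fun g => [g.1.tail, g.2.1, [], bad' g, [], res' g]) :=
        h1.seq (h2.seq (h3.seq (h4.seq h5)))
      refine (h7.seq h6).mono (fun _ h => h) ?_
      rintro ⟨rem, z, tmp, bad⟩ t ⟨-, h⟩ rfl
      rcases rem with _ | ⟨b, rem⟩
      · simp [input_apply] at h
      · have hb : b = false := by simpa [input_apply] using h
        subst hb
        refine ⟨rem, [], _, rfl, by simp, ?_, ?_⟩
        · simp only [bad']
          split_ifs <;> simp <;> omega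
        · have := hout (tmp.reverse, z) trivial
          simp only [scan, bad', ← this]
          split_ifs with h'
          · simp [h']
          · simp [h']
    · set D : List Bool × List Bool × List Bool × List Bool → Prop :=
        fun g => g.1 ≠ [] ∧ (input [g.1, g.2.1, g.2.2.1, g.2.2.2] 0).head? = some true
      have h1 : PolyStep O (.pop 0) D (fun g => [g.1, g.2.1, g.2.2.1, g.2.2.2])
          (fun g => [g.1.tail, g.2.1, g.2.2.1, g.2.2.2]) := .pop (by simp)
      have h2 : PolyStep O (.pop 0) (fun g => D g ∧ g.1.tail ≠ [])
          (fun g => [g.1.tail, g.2.1, g.2.2.1, g.2.2.2])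
          (fun g => [g.1.tail.tail, g.2.1, g.2.2.1, g.2.2.2]) := .pop (by simp)
      have h3 : ∀ b, PolyStep O (.push 2 b) (fun g => D g ∧ g.1.tail ≠ [])
          (fun g => [g.1.tail.tail, g.2.1, g.2.2.1, g.2.2.2])
          (fun g => [g.1.tail.tail, g.2.1, b :: g.2.2.1, g.2.2.2]) := fun b => .push (by simp)
      refine h1.seq (.cond ?_ ?_ ?_)
      · refine (PolyStep.push (by simp)).mono (fun _ h => h) ?_
        rintro ⟨rem, z, tmp, bad⟩ t ⟨⟨-, h⟩, h0⟩ rfl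
        rcases rem with _ | ⟨b, rem⟩
        · simp [input_apply] at h
        · have hb : b = true := by simpa [input_apply] using h
          have h0 : rem = [] := h0
          subst hb h0
          refine ⟨[], tmp, true :: bad, rfl, by simp, by simp; omega, by simp [scan]⟩
      all_goals
        refine ((h2.seq (h3 _)).mono (D' := fun g => D g ∧ _) ?_ ?_)
        · rintro ⟨rem, z, tmp, bad⟩ ⟨h, h0⟩
          refine ⟨h, fun h1 => ?_⟩
          have h1 : rem.tail = [] := h1
          simp [input_apply, h1] at h0
        · rintro ⟨rem, z, tmp, bad⟩ t ⟨⟨-, h⟩, h0⟩ rfl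
          rcases rem with _ | ⟨b, _ | ⟨b', rem⟩⟩
          · simp [input_apply] at h
          · simp [input_apply] at h0
          · have hb : b = true := by simpa [input_apply] using h
            have hb' : some b' = some _ := h0
            obtain rfl := Option.some.inj hb'
            subst hb
            exact ⟨rem, _, bad, rfl, by simp, by simp; omega, by simp [scan]⟩
  obtain ⟨q, hq⟩ := hbody
  refine ⟨.seq (.loop 0 body) (.cond 3 (.cond 2 (.push 0 true) (.push 0 false) (.push 0 false))
    (.push 0 false) (.push 0 false)), Polynomial.X * (q + 1) + 4, ?_⟩
  rintro ⟨w, z⟩ - N hN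
  have hw : w.length ≤ N := hN 0
  have hz : z.length ≤ N := hN 1
  obtain ⟨m, hm, t, hr, ⟨rem, tmp, bad, rfl, -, ht⟩, h0⟩ := run_loop (O := O) (c := body) (i := 0)
    (T := q.eval N) (fun s => ∃ rem tmp bad, s = input [rem, z, tmp, bad] ∧
      rem.length + tmp.length + bad.length ≤ w.length ∧
      (scan (p · z) [] w ↔ bad = [] ∧ scan (p · z) tmp rem)) (by
      rintro _ ⟨rem, tmp, bad, rfl, hle, h⟩ h0
      obtain ⟨m, hm, t, hr, rem', tmp', bad', rfl, hlt, hle', h'⟩ := hq (rem, z, tmp, bad) h0 N (by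
        intro i
        rcases i with _ | _ | _ | _ | i <;> simp [input_apply] <;> omega)
      exact ⟨m, hm, _, hr, ⟨rem', tmp', bad', rfl, hle'.trans hle, h.trans h'⟩, hlt⟩)
    (input [w, z]) ⟨w, [], [], ((input_append_nil [w, z, []]).trans (input_append_nil [w, z])).symm,
      by simp, by simp⟩
  have hu : rem = [] := h0
  subst hu
  have hpush : ∀ b, Run O (.push 0 b) (input [[], z, tmp, bad]) 1 (input [[b], z, tmp, bad]) := by
    intro b
    have := Run.push (O := O) 0 b (input [[], z, tmp, bad])
    rwa [update_input _ (by simp)] at this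
  have hm : m ≤ N * (q.eval N + 1) + 1 := hm.trans (by
    simp only [input_apply, List.getD_cons_zero]; gcongr)
  simp only [Polynomial.eval_add, Polynomial.eval_mul, Polynomial.eval_X, Polynomial.eval_ofNat,
    Polynomial.eval_one]
  have hs := scan_iff (p · z) [] w
  rw [ht] at hs
  simp only [List.reverse_nil, List.flatMap_nil, List.nil_append, scan] at hs
  rw [← hs]
  rcases bad with _ | ⟨b, bad⟩
  · rcases tmp with _ | ⟨b, tmp⟩
    · exact ⟨m + (1 + 1 + 1), by omega, _, hr.seq (.cond_nil rfl (.cond_nil rfl (hpush _))), by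
        simp [input_apply]⟩
    · refine ⟨m + (1 + 1 + 1), by omega, input [[false], z, b :: tmp, []],
        hr.seq (.cond_nil rfl ?_), by simp [input_apply]⟩
      cases b
      · exact .cond_false rfl (hpush _)
      · exact .cond_true rfl (hpush _)
  · refine ⟨m + (1 + 1), by omega, input [[false], z, tmp, b :: bad], hr.seq ?_, by
        simp [input_apply]⟩
    cases b
    · exact .cond_false rfl (hpush _)
    · exact .cond_true rfl (hpush _)

/-! ### Bounds on the length of certificates, and the join of two `NP`-problems -/

/-- A program that removes `p.eval x.length` symbols from the second of two registers. -/
theorem exists_run_drop (O : Problem) (p : Polynomial ℕ) :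
    ∃ (c : Prog) (q : Polynomial ℕ), ∀ x w : List Bool, ∃ m ≤ q.eval x.length,
      Run O c (input [x, w]) m (input [x, w.drop (p.eval x.length)]) := by
  -- No arithmetic is needed: a constant is a number of pops, a sum is a sequence of programs, and a
  -- further factor `X` is a loop over a copy of `x`.
  induction p using Polynomial.induction_on with
  | C a =>
    induction a with
    | zero => exact ⟨.skip, 1, fun x w => ⟨1, by simp, by simpa using Run.skip _⟩⟩
    | succ a ih =>
      obtain ⟨c, q, h⟩ := ih
      refine ⟨.seq c (.pop 1), q + 1, fun x w => ?_⟩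
      obtain ⟨m, hm, hr⟩ := h x w
      refine ⟨m + 1, by simpa using hm, hr.seq ?_⟩
      have := Run.pop (O := O) 1 (input [x, w.drop ((Polynomial.C a).eval x.length)])
      rw [update_input _ (by simp)] at this
      rw [map_add, Polynomial.eval_add, ← List.drop_drop]
      simpa [input_apply] using this
  | add p₁ p₂ ih₁ ih₂ =>
    obtain ⟨c₁, q₁, h₁⟩ := ih₁
    obtain ⟨c₂, q₂, h₂⟩ := ih₂
    refine ⟨.seq c₁ c₂, q₁ + q₂, fun x w => ?_⟩
    obtain ⟨m₁, hm₁, hr₁⟩ := h₁ x w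
    obtain ⟨m₂, hm₂, hr₂⟩ := h₂ x (w.drop (p₁.eval x.length))
    rw [List.drop_drop, ← Polynomial.eval_add] at hr₂
    exact ⟨m₁ + m₂, by rw [Polynomial.eval_add]; omega, hr₁.seq hr₂⟩
  | monomial n a ih =>
    obtain ⟨c, q, h⟩ := ih
    set p := Polynomial.C a * Polynomial.X ^ n with hp
    -- This renaming keeps the arguments in place and frees stack 2 for the loop counter.
    let f : ℕ → ℕ := fun i => if i < 2 then i else i + 1
    have hf : Injective f := by
      intro i j hij
      simp only [f] at hij
      split_ifs at hij <;> omega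
    have hext : ∀ x v v' u : List Bool,
        extend f (input [x, v]) (input [x, v', u]) = input [x, v, u] := by
      intro x v v' u
      funext j
      rcases j with _ | _ | _ | j
      · exact hf.extend_apply _ _ 0
      · exact hf.extend_apply _ _ 1
      · rw [extend_apply']
        · rfl
        · rintro ⟨i, hi⟩
          simp only [f] at hi
          split_ifs at hi <;> omega
      · exact hf.extend_apply _ _ (j + 2)
    let body : Prog := .seq (.pop 2) (c.rename f)
    refine ⟨.seq (copy 0 2 3) (.loop 2 body), 9 * Polynomial.X + 3 + Polynomial.X * (1 + q + 1),
      fun x w => ?_⟩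
    have h1 : Run O (copy 0 2 3) (input [x, w]) (9 * x.length + 2) (input [x, w, x]) := by
      have := run_copy O (i := 0) (j := 2) (k := 3) (by omega) (by omega) (by omega)
        (input [x, w]) rfl
      rw [update_input_length _ (by simp)] at this
      simpa [input_apply] using this
    obtain ⟨m, hm, t, hr, ⟨v, u, rfl, hu⟩, h0⟩ := run_loop (O := O) (c := body) (i := 2)
      (T := 1 + q.eval x.length) (fun s => ∃ v u, s = input [x, v, u] ∧
        w.drop (x.length * p.eval x.length) = v.drop (u.length * p.eval x.length)) (by
        rintro _ ⟨v, u, rfl, hu⟩ h0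
        rcases u with _ | ⟨b, u⟩
        · exact absurd rfl h0
        · obtain ⟨m, hm, hr⟩ := h x v
          have e1 := Run.pop (O := O) 2 (input [x, v, b :: u])
          rw [update_input _ (by simp)] at e1
          have e2 := hr.rename hf (input [x, v, u])
          rw [hext, hext] at e2
          refine ⟨1 + m, by omega, _, e1.seq e2, ⟨_, u, rfl, ?_⟩, by simp [input_apply]⟩
          rw [hu, List.drop_drop]
          simp [add_mul, add_comm])
      (input [x, w, x]) ⟨w, x, rfl, rfl⟩
    have hu0 : u = [] := h0
    subst hu0
    refine ⟨9 * x.length + 2 + m, ?_, h1.seq ?_⟩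
    · have hm : m ≤ x.length * (1 + q.eval x.length + 1) + 1 := hm
      simp only [Polynomial.eval_add, Polynomial.eval_mul, Polynomial.eval_X,
        Polynomial.eval_ofNat, Polynomial.eval_one]
      omega
    · have e : (Polynomial.C a * Polynomial.X ^ (n + 1)).eval x.length =
          x.length * p.eval x.length := by
        simp [hp]; ring
      rw [e, hu]
      rw [← input_append_nil [x, v.drop _]]
      simpa using hr

/-- A program that compares the length of a string with a polynomial of the length of another. -/
theorem exists_decides_length_le (O : Problem) (p : Polynomial ℕ) :
    ∃ c, Decides O c (fun x w => w.length ≤ p.eval x.length) := by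
  obtain ⟨c, q, h⟩ := exists_run_drop O p
  refine ⟨.seq c (.cond 1 (.push 0 true) (.push 0 false) (.push 0 false)), q + 2, ?_⟩
  rintro ⟨x, w⟩ - N hN
  obtain ⟨m, hm, hr⟩ := h x w
  have hm : m ≤ q.eval N := hm.trans (eval_mono q (hN 0))
  have hpush : ∀ v b, Run O (.push 0 b) (input [x, v]) 1 (input [b :: x, v]) := by
    intro v b
    have := Run.push (O := O) 0 b (input [x, v])
    rwa [update_input _ (by simp)] at this
  have hw : w.length ≤ p.eval x.length ↔ w.drop (p.eval x.length) = [] := by simp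
  simp only [hw]
  generalize w.drop (p.eval x.length) = v at hr
  have key : ∃ b, Run O (.cond 1 (.push 0 true) (.push 0 false) (.push 0 false)) (input [x, v]) 2
      (input [b :: x, v]) ∧ (b = true ↔ v = []) := by
    rcases v with _ | ⟨_ | _, v⟩
    · exact ⟨true, .cond_nil rfl (hpush _ _), by simp⟩
    · exact ⟨false, .cond_false rfl (hpush _ _), by simp⟩
    · exact ⟨false, .cond_true rfl (hpush _ _), by simp⟩
  obtain ⟨b, hb, hv⟩ := key
  exact ⟨m + 2, by simpa using hm, _, hr.seq hb, by simp [input_apply, hv]⟩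

/-- The disjoint union of two problems. -/
def join (A B : Problem) : Problem :=
  {x | (∃ y ∈ A, x = false :: y) ∨ ∃ y ∈ B, x = true :: y}

theorem simulates_join_left (A B : Problem) : Simulates (join A B) A := fun c =>
  ⟨c.mark false, 2, fun _ _ _ h => h.mark (by simp [join])⟩

theorem simulates_join_right (A B : Problem) : Simulates (join A B) B := fun c =>
  ⟨c.mark true, 2, fun _ _ _ h => h.mark (by simp [join])⟩

/-- The verifier of an `NP`-problem can be made to reject certificates that are too long. -/
theorem exists_decides_of_mem_NP {A : Problem} (hA : A ∈ NP) :
    ∃ (c : Prog) (v : List Bool → List Bool → Prop) (p : Polynomial ℕ), Decides ∅ c v ∧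
      (∀ x w, v x w → w.length ≤ p.eval x.length) ∧ ∀ x, x ∈ A ↔ ∃ w, v x w := by
  obtain ⟨V, p, q, hV, hA⟩ := hA
  obtain ⟨c, hc⟩ := exists_decides_length_le ∅ p
  obtain ⟨e, he⟩ := hc.and (decides_of_accepts q hV fun _ _ => Iff.rfl)
  exact ⟨e, _, p, he, fun x w h => h.1, hA⟩

theorem mem_NP_of_decides {A : Problem} {c : Prog} {v : List Bool → List Bool → Prop}
    {p : Polynomial ℕ} (hc : Decides ∅ c v) (hv : ∀ x w, v x w → w.length ≤ p.eval x.length)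
    (hA : ∀ x, x ∈ A ↔ ∃ w, v x w) : A ∈ NP := by
  obtain ⟨q, hq, ha⟩ := hc.accepts
  refine ⟨c, p, q, hq, fun x => ?_⟩
  simp only [ha, hA]
  exact ⟨fun ⟨w, hw⟩ => ⟨w, hv x w hw, hw⟩, fun ⟨w, _, hw⟩ => ⟨w, hw⟩⟩

theorem empty_mem_NP : (∅ : Problem) ∈ NP := by
  refine mem_NP_of_decides (c := .push 0 false) (v := fun _ _ => False) (p := 0) ?_ (by simp)
    (by simp)
  refine (PolyStep.push (by simp)).mono (fun _ h => h) ?_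
  rintro g t - rfl
  simp [input_apply]

/-- The first bit of the input selects the verifier. The common certificate bound `p + q` exceeds
the individual ones, so both verifiers must first be made to reject certificates that are too long
for them. -/
theorem join_mem_NP {A B : Problem} (hA : A ∈ NP) (hB : B ∈ NP) : join A B ∈ NP := by
  obtain ⟨c, v, p, hc, hv, hA⟩ := exists_decides_of_mem_NP hA
  obtain ⟨d, u, q, hd, hu, hB⟩ := exists_decides_of_mem_NP hB
  let r : List Bool → List Bool → Prop := fun x w =>
    (∃ y, x = false :: y ∧ v y w) ∨ ∃ y, x = true :: y ∧ u y w
  refine mem_NP_of_decides (c := .cond 0 (.push 0 false) (.seq (.pop 0) c) (.seq (.pop 0) d))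
    (v := r) (p := p + q) (.cond ?_ ?_ ?_) ?_ ?_
  · refine (PolyStep.push (by simp)).mono (fun _ h => h) ?_
    rintro ⟨x, w⟩ t ⟨-, h⟩ rfl
    have h : x = [] := h
    simp [r, h, input_apply]
  · have h1 : PolyStep ∅ (.pop 0)
        (fun g => True ∧ (input [g.1, g.2] 0).head? = some false)
        (fun g : List Bool × List Bool => [g.1, g.2]) (fun g => [g.1.tail, g.2]) :=
      .pop (by simp)
    refine h1.seq ((hc.reindex fun g : List Bool × List Bool => (g.1.tail, g.2)).mono
      (fun _ _ => trivial) ?_)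
    rintro ⟨x, w⟩ t ⟨-, h⟩ ht
    have h : x.head? = some false := h
    rcases x with _ | ⟨b, x⟩
    · simp at h
    · have hb : b = false := by simpa using h
      subst hb
      rw [ht]
      simp [r]
  · have h1 : PolyStep ∅ (.pop 0)
        (fun g => True ∧ (input [g.1, g.2] 0).head? = some true)
        (fun g : List Bool × List Bool => [g.1, g.2]) (fun g => [g.1.tail, g.2]) :=
      .pop (by simp)
    refine h1.seq ((hd.reindex fun g : List Bool × List Bool => (g.1.tail, g.2)).mono
      (fun _ _ => trivial) ?_)
    rintro ⟨x, w⟩ t ⟨-, h⟩ ht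
    have h : x.head? = some true := h
    rcases x with _ | ⟨b, x⟩
    · simp at h
    · have hb : b = true := by simpa using h
      subst hb
      rw [ht]
      simp [r]
  · rintro x w (⟨y, rfl, h⟩ | ⟨y, rfl, h⟩)
    · refine (hv y w h).trans ((eval_mono p (Nat.le_succ _)).trans ?_)
      simp
    · refine (hu y w h).trans ((eval_mono q (Nat.le_succ _)).trans ?_)
      simp
  · intro x
    simp only [join, Set.mem_ofPred_eq, hA, hB, r]
    constructor
    · rintro (⟨y, ⟨w, h⟩, rfl⟩ | ⟨y, ⟨w, h⟩, rfl⟩)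
      · exact ⟨w, .inl ⟨y, rfl, h⟩⟩
      · exact ⟨w, .inr ⟨y, rfl, h⟩⟩
    · rintro ⟨w, ⟨y, rfl, h⟩ | ⟨y, rfl, h⟩⟩
      · exact .inl ⟨y, ⟨w, h⟩, rfl⟩
      · exact .inr ⟨y, ⟨w, h⟩, rfl⟩

/-! ### Counting -/

/-- If all `t`-tuples over `C` are mapped to a set `Y` with at most `2 ^ t` elements, then few
elements of `Y` suffice such that every element of `C` occurs in a tuple that is mapped to one of
them. -/
theorem exists_covering_values {α β : Type*} (f : List α → β) (Y : Finset β)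
    {t : ℕ} (ht : 0 < t) (hY : Y.card ≤ 2 ^ t) (k : ℕ) (C : Finset α) (hC : C.card < 2 ^ k)
    (hf : ∀ xs : List α, xs.length = t → (∀ x ∈ xs, x ∈ C) → f xs ∈ Y) :
    ∃ S ⊆ Y, S.card ≤ k ∧ ∀ x ∈ C, ∃ xs : List α, xs.length = t ∧ (∀ y ∈ xs, y ∈ C) ∧ x ∈ xs ∧
      f xs ∈ S := by
  classical
  induction k generalizing C with
  | zero =>
    have : C = ∅ := by simpa using hC
    exact ⟨∅, by simp, by simp, by simp [this]⟩
  | succ k ih =>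
    rcases C.eq_empty_or_nonempty with rfl | hne
    · exact ⟨∅, by simp, by simp, by simp⟩
    let T : Finset (Fin t → α) := Fintype.piFinset fun _ => C
    have hT : ∀ v ∈ T, f (List.ofFn v) ∈ Y := fun v hv =>
      hf _ (by simp) (by simpa [List.forall_mem_ofFn_iff, T] using hv)
    let U : β → Finset α := fun y =>
      C.filter fun x => ∃ v ∈ T, f (List.ofFn v) = y ∧ ∃ i, v i = x
    -- Otherwise the tuples mapped to `y` lie in `U y ^ t`, of size less than `(|C| / 2) ^ t`, and
    -- at most `2 ^ t` such fibres cannot exhaust `C ^ t`.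
    have hU : ∃ y ∈ Y, C.card ≤ 2 * (U y).card := by
      by_contra! hlt
      have h1 : ∀ y ∈ Y, (T.filter fun v => f (List.ofFn v) = y).card ≤ (U y).card ^ t := by
        intro y _
        have : (T.filter fun v => f (List.ofFn v) = y) ⊆ Fintype.piFinset fun _ => U y := by
          intro v hv
          rw [Finset.mem_filter] at hv
          rw [Fintype.mem_piFinset]
          intro i
          exact Finset.mem_filter.mpr ⟨Fintype.mem_piFinset.mp hv.1 i, v, hv.1, hv.2, i, rfl⟩
        simpa using Finset.card_le_card this
      have h2 : C.card ^ t ≤ ∑ y ∈ Y, (U y).card ^ t := by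
        have := Finset.card_eq_sum_card_fiberwise (s := T) (t := Y) hT
        have hc : T.card = C.card ^ t := by simp [T]
        rw [← hc, this]
        exact Finset.sum_le_sum h1
      have hYne : Y.Nonempty := by
        obtain ⟨x, hx⟩ := hne
        exact ⟨_, hT (fun _ => x) (by simp [T, hx])⟩
      have h3 : 2 ^ t * C.card ^ t < 2 ^ t * C.card ^ t := by
        calc 2 ^ t * C.card ^ t ≤ 2 ^ t * ∑ y ∈ Y, (U y).card ^ t := by gcongr
          _ = ∑ y ∈ Y, (2 * (U y).card) ^ t := by
            rw [Finset.mul_sum]; simp only [mul_pow]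
          _ < ∑ _y ∈ Y, C.card ^ t :=
            Finset.sum_lt_sum_of_nonempty hYne fun y hy =>
              Nat.pow_lt_pow_left (hlt y hy) ht.ne'
          _ = Y.card * C.card ^ t := by simp
          _ ≤ 2 ^ t * C.card ^ t := by gcongr
      exact lt_irrefl _ h3
    obtain ⟨y, hy, hcard⟩ := hU
    have hsub : U y ⊆ C := Finset.filter_subset _ _
    -- Removing `U y` discards at least half of `C`, and tuples over the rest are still tuples over
    -- `C`.
    obtain ⟨S, hS, hSk, hcov⟩ := ih (C \ U y) (by
        rw [Finset.card_sdiff_of_subset hsub]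
        rw [pow_succ] at hC
        omega)
      fun xs hxs h => hf xs hxs fun x hx => (Finset.mem_sdiff.mp (h x hx)).1
    refine ⟨insert y S, Finset.insert_subset hy hS, (Finset.card_insert_le _ _).trans (by omega),
      fun x hx => ?_⟩
    by_cases hxU : x ∈ U y
    · obtain ⟨-, v, hv, hvy, i, rfl⟩ := Finset.mem_filter.mp hxU
      exact ⟨List.ofFn v, by simp, by simpa [List.forall_mem_ofFn_iff, T] using hv,
        List.mem_ofFn.mpr ⟨i, rfl⟩, by simp [hvy]⟩
    · obtain ⟨xs, h1, h2, h3, h4⟩ := hcov x (Finset.mem_sdiff.mpr ⟨hx, hxU⟩)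
      exact ⟨xs, h1, fun u hu => (Finset.mem_sdiff.mp (h2 u hu)).1, h3, by simp [h4]⟩

/-- The bit strings of length `n`. -/
def strings (n : ℕ) : Finset (List Bool) :=
  (Finset.univ : Finset (Fin n → Bool)).image List.ofFn

theorem mem_strings {n : ℕ} {x : List Bool} : x ∈ strings n ↔ x.length = n := by
  simp only [strings, Finset.mem_image, Finset.mem_univ, true_and]
  constructor
  · rintro ⟨v, rfl⟩; simp
  · rintro rfl; exact ⟨x.get, by simp⟩

theorem card_strings_le (n : ℕ) : (strings n).card ≤ 2 ^ n :=
  Finset.card_image_le.trans (by simp)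

theorem card_biUnion_strings_le (n : ℕ) :
    ((Finset.range n).biUnion strings).card ≤ 2 ^ n := by
  refine Finset.card_biUnion_le.trans ((Finset.sum_le_sum fun i _ => card_strings_le i).trans ?_)
  rw [Nat.geomSum_eq le_rfl]
  exact (Nat.div_le_self _ _).trans (Nat.sub_le _ _)

/-- The values of `f` on suitable tuples certify that a string of length `n` is not mapped into `L`
by `ρ`. -/
theorem exists_certifying_values {R : Setoid (List Bool)} {L Q : Problem}
    {ρ : List Bool → List Bool} {f : List (List Bool) → List Bool} {n m t B c : ℕ}
    (hρ : ∀ x : List Bool, x.length = n → (ρ x).length ≤ m)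
    (hR : ∀ S : Finset (List Bool), S.sup List.length ≤ m →
      ((fun x => Quotient.mk R x) '' (S : Set (List Bool))).ncard ≤ c)
    (hf : ∀ xs : List (List Bool), xs.length = t → (∀ x ∈ xs, ∀ y ∈ xs, R x y) →
      (∀ x ∈ xs, x.length ≤ m) → (f xs).length ≤ B ∧ (f xs ∈ Q ↔ ∃ x ∈ xs, x ∈ L))
    (ht : B + 1 ≤ t) :
    ∃ ys : List (List Bool), ys.length ≤ c * (n + 1) ∧ (∀ y ∈ ys, y.length ≤ B ∧ y ∉ Q) ∧
      ∀ x : List Bool, x.length = n → ρ x ∉ L → ∃ xs : List (List Bool), xs.length = t ∧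
        (∀ u ∈ xs, u.length ≤ m ∧ R u (ρ x)) ∧ ρ x ∈ xs ∧ f xs ∈ ys := by
  classical
  -- `Z` collects the no-instances among the images under `ρ`, `Y` their possible values, and `C q`
  -- is the part of `Z` in the class `q`, since `f` is controlled only on equivalent strings.
  let Z : Finset (List Bool) := ((strings n).image ρ).filter (· ∉ L)
  let Y : Finset (List Bool) := ((Finset.range (B + 1)).biUnion strings).filter (· ∉ Q)
  let C : Quotient R → Finset (List Bool) := fun q => Z.filter fun z => Quotient.mk R z = q
  have hZ : ∀ z ∈ Z, z.length ≤ m ∧ z ∉ L := by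
    intro z hz
    simp only [Z, Finset.mem_filter, Finset.mem_image, mem_strings] at hz
    obtain ⟨⟨x, hx, rfl⟩, h⟩ := hz
    exact ⟨hρ x hx, h⟩
  have hYcard : Y.card ≤ 2 ^ t :=
    (Finset.card_le_card (Finset.filter_subset _ _)).trans
      ((card_biUnion_strings_le _).trans (Nat.pow_le_pow_right (by norm_num) ht))
  have hC : ∀ q, ∃ S ⊆ Y, S.card ≤ n + 1 ∧ ∀ x ∈ C q, ∃ xs : List (List Bool), xs.length = t ∧
      (∀ y ∈ xs, y ∈ C q) ∧ x ∈ xs ∧ f xs ∈ S := by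
    intro q
    refine exists_covering_values f Y (by omega) hYcard (n + 1) (C q) ?_ ?_
    -- The images are counted through their preimages of length `n`, so `n + 1` rounds suffice
    -- whatever their lengths are.
    · calc (C q).card ≤ Z.card := Finset.card_le_card (Finset.filter_subset _ _)
        _ ≤ ((strings n).image ρ).card := Finset.card_le_card (Finset.filter_subset _ _)
        _ ≤ (strings n).card := Finset.card_image_le
        _ ≤ 2 ^ n := card_strings_le n
        _ < 2 ^ (n + 1) := Nat.pow_lt_pow_right (by norm_num) (Nat.lt_succ_self n)
    · intro xs hxs h
      have hx : ∀ x ∈ xs, x ∈ Z ∧ Quotient.mk R x = q := fun x hx => Finset.mem_filter.mp (h x hx)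
      obtain ⟨h1, h2⟩ := hf xs hxs
        (fun x h y h' => Quotient.exact ((hx x h).2.trans (hx y h').2.symm))
        (fun x h => (hZ x (hx x h).1).1)
      refine Finset.mem_filter.mpr ⟨?_, ?_⟩
      · simp only [Finset.mem_biUnion, mem_strings, Finset.mem_range]
        exact ⟨_, by omega, rfl⟩
      · rw [h2]
        rintro ⟨x, h, h'⟩
        exact (hZ x (hx x h).1).2 h'
  choose S hSY hS hcov using hC
  refine ⟨((Z.image (Quotient.mk R)).biUnion S).toList, ?_, ?_, ?_⟩
  · rw [Finset.length_toList]
    -- At most `c` classes meet `Z`, and each contributes at most `n + 1` values.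
    refine (Finset.card_biUnion_le_card_mul _ _ _ fun q _ => hS q).trans ?_
    gcongr
    have := hR Z (Finset.sup_le fun z hz => (hZ z hz).1)
    rwa [← Finset.coe_image, Set.ncard_coe_finset] at this
  · intro y hy
    simp only [Finset.mem_toList, Finset.mem_biUnion] at hy
    obtain ⟨q, -, hy⟩ := hy
    have := hSY q hy
    simp only [Y, Finset.mem_filter, Finset.mem_biUnion, mem_strings, Finset.mem_range] at this
    obtain ⟨⟨_, h, rfl⟩, h'⟩ := this
    exact ⟨by omega, h'⟩
  · intro x hx hxL
    have hz : ρ x ∈ Z := by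
      simp only [Z, Finset.mem_filter, Finset.mem_image, mem_strings]
      exact ⟨⟨x, hx, rfl⟩, hxL⟩
    obtain ⟨xs, h1, h2, h3, h4⟩ := hcov (Quotient.mk R (ρ x)) (ρ x)
      (Finset.mem_filter.mpr ⟨hz, rfl⟩)
    refine ⟨xs, h1, fun u hu => ?_, h3, ?_⟩
    · obtain ⟨h, h'⟩ := Finset.mem_filter.mp (h2 u hu)
      exact ⟨(hZ u h).1, Quotient.exact h'⟩
    · simp only [Finset.mem_toList, Finset.mem_biUnion]
      exact ⟨_, Finset.mem_image_of_mem _ hz, h4⟩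

/-- A polynomial number `t` of strings exceeds a given polynomial in `m + log t`. -/
theorem exists_polynomial_tuple_length (P : Polynomial ℕ) :
    ∃ T : Polynomial ℕ, ∀ m, ∃ t ≤ T.eval m, P.eval (m + Nat.log 2 t) + 1 ≤ t := by
  -- `K` is a threshold from which the exponential dominates the polynomial.
  obtain ⟨K, hK⟩ : ∃ K, ∀ s ≥ K, P.eval (2 * s) + 1 ≤ 2 ^ s := by
    set p := P.comp (2 * Polynomial.X) + 1 with hp
    have h1 : (fun s : ℕ => ∑ i ∈ Finset.range (p.natDegree + 1), (p.coeff i : ℝ) * (s : ℝ) ^ i)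
        =o[Filter.atTop] fun s => (2 : ℝ) ^ s :=
      .fun_sum fun i _ =>
        (isLittleO_pow_const_const_pow_of_one_lt i one_lt_two).const_mul_left _
    obtain ⟨K, hK⟩ := Filter.eventually_atTop.mp (h1.bound one_pos)
    refine ⟨K, fun s hs => ?_⟩
    have h2 := (le_abs_self _).trans (hK s hs)
    have h3 : p.eval s = P.eval (2 * s) + 1 := by simp [hp]
    rw [← h3, Polynomial.eval_eq_sum_range]
    rw [one_mul, norm_pow, Real.norm_ofNat] at h2
    exact_mod_cast h2
  refine ⟨Polynomial.C (2 ^ K) * (2 * (P.comp (2 * Polynomial.X) + 1)), fun m => ?_⟩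
  set v := P.eval (2 * m) + 1 with hv
  -- Taking `t = 2 ^ s` makes its logarithm exactly `s`. If `m ≤ s`, then `P.eval (2 * s)` is beaten
  -- because `s ≥ K`; if `s ≤ m`, then `P.eval (2 * m) + 1 = v ≤ 2 ^ s`.
  refine ⟨2 ^ (K + Nat.clog 2 v), ?_, ?_⟩
  · have h1 : 2 ^ Nat.clog 2 v ≤ 2 * v := by
      rcases Nat.lt_or_ge 1 v with h | h
      · have := Nat.pow_pred_clog_lt_self (b := 2) (by norm_num) h
        have h0 : 0 < Nat.clog 2 v := Nat.clog_pos (by norm_num) h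
        obtain ⟨j, hj⟩ := Nat.exists_eq_succ_of_ne_zero h0.ne'
        rw [hj] at this ⊢
        rw [pow_succ]
        simp only [Nat.succ_eq_add_one, Nat.pred_succ] at this
        omega
      · rw [Nat.clog_of_right_le_one h]; omega
    rw [pow_add]
    simpa [← hv] using Nat.mul_le_mul_left (2 ^ K) h1
  · rw [Nat.log_pow (by norm_num)]
    set s := K + Nat.clog 2 v with hs
    rcases le_total m s with h | h
    · exact (Nat.succ_le_succ (eval_mono P (show m + s ≤ 2 * s by omega))).trans (hK s (by omega))
    · calc P.eval (m + s) + 1 ≤ v := Nat.succ_le_succ (eval_mono P (by omega))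
        _ ≤ 2 ^ Nat.clog 2 v := Nat.le_pow_clog (by norm_num) v
        _ ≤ 2 ^ s := Nat.pow_le_pow_right (by norm_num) (by omega)

/-! ### The verifier -/

theorem PolyRun.congr_input {O : Problem} {c : Prog} {ι : Type} {D : ι → Prop} {s s' : ι → Store}
    {Q : ι → Store → Prop} (h : PolyRun O c D s Q) (hs : ∀ g, D g → s g = s' g) :
    PolyRun O c D s' Q := by
  obtain ⟨q, hq⟩ := h
  refine ⟨q, fun g hg N hN => ?_⟩
  rw [← hs g hg] at hN ⊢
  exact hq g hg N hN

/-- The string `x`, the advice `a` and the certificate `w` are accepted if `w` encodes a sequence of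
pairwise equivalent strings that contains `ρ x` and on which the value of `f` is on the list encoded
by `a`. -/
def Certifies (R : List Bool → List Bool → Prop) (ρ : List Bool → List Bool)
    (f : List (List Bool) → List Bool) (x a w : List Bool) : Prop :=
  ∃ xs, w = encodeList xs ∧ (∀ u ∈ xs, R u (ρ x)) ∧ ρ x ∈ xs ∧
    ¬ ∃ ys, a = encodeList ys ∧ ∀ y ∈ ys, y ≠ f xs

/-- Membership in a list is tested as the failure of "all entries differ", so the list scanner
serves for every check. Outside `D` the cross-composition `cc` need not halt; it is run only once
the certificate is known to be a list of strings equivalent to `ρ x` that contains `ρ x`. -/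
theorem exists_verifier {O : Problem} {cr cR cc ck : Prog} {R : List Bool → List Bool → Prop}
    {D : List (List Bool) → Prop} {outr : List Bool → Store} {outc : List (List Bool) → Store}
    {outk : List Bool × ℕ → Store}
    (hr : PolyRun O cr (fun _ => True) (fun x => input [x]) (fun x t => t = outr x))
    (hR : Decides O cR R)
    (hc : PolyRun O cc D (fun xs => input [encodeList xs]) (fun xs t => t = outc xs))
    (hcu : ∀ xs, D xs → outc xs 1 = unary (outc xs 1).length)
    (hk : PolyRun O ck (fun _ => True) (fun g => input [g.1, unary g.2]) (fun g t => t = outk g))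
    (hD : ∀ xs z, z ∈ xs → (∀ u ∈ xs, R u z) → D xs) :
    ∃ V, PolyRun O V (fun _ => True)
      (fun g : List Bool × List Bool × List Bool => input [g.1, g.2.1, g.2.2])
      (fun g t => (t 0).head? = some true ↔ Certifies R (fun x => outr x 0)
        (fun xs => outk (outc xs 0, (outc xs 1).length) 0) g.1 g.2.1 g.2.2) := by
  obtain ⟨cA, hA⟩ := hR.forall_mem
  obtain ⟨outA, hA, hAout⟩ :=
    PolyRun.exists_fun (l := fun g : List Bool × List Bool => [g.1, g.2]) hA
  obtain ⟨cn, hn⟩ := exists_decides_ne O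
  obtain ⟨cN, hN⟩ := hn.forall_mem
  obtain ⟨outN, hN, hNout⟩ :=
    PolyRun.exists_fun (l := fun g : List Bool × List Bool => [g.1, g.2]) hN
  -- On strings that are not encodings `dec` is arbitrary; the program uses its values only under
  -- `D₁`.
  set dec : List Bool → List (List Bool) := invFun encodeList
  have hdec : ∀ xs, dec (encodeList xs) = xs := leftInverse_invFun encodeList_injective
  let f : List (List Bool) → List Bool := fun xs => outk (outc xs 0, (outc xs 1).length) 0
  let A : List Bool × List Bool × List Bool → List Bool := fun g => outA (g.2.2, outr g.1 0) 0
  let B : List Bool × List Bool × List Bool → List Bool := fun g => outN (g.2.2, outr g.1 0) 0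
  let E : List Bool × List Bool × List Bool → List Bool := fun g => outN (g.2.1, f (dec g.2.2)) 0
  have hAg : ∀ g, (A g).head? = some true ↔
      ∃ xs, g.2.2 = encodeList xs ∧ ∀ u ∈ xs, R u (outr g.1 0) := fun g => hAout _ trivial
  have hBg : ∀ g, (B g).head? = some true ↔
      ∃ xs, g.2.2 = encodeList xs ∧ ∀ u ∈ xs, u ≠ outr g.1 0 := fun g => hNout _ trivial
  have hEg : ∀ g, (E g).head? = some true ↔
      ∃ ys, g.2.1 = encodeList ys ∧ ∀ y ∈ ys, y ≠ f (dec g.2.2) := fun g => hNout _ trivial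
  let D₁ : List Bool × List Bool × List Bool → Prop := fun g =>
    (A g).head? = some true ∧ (B g).head? ≠ some true
  have hD₁ : ∀ g, D₁ g → g.2.2 = encodeList (dec g.2.2) ∧ (∀ u ∈ dec g.2.2, R u (outr g.1 0)) ∧
      outr g.1 0 ∈ dec g.2.2 := by
    rintro g ⟨h1, h2⟩
    rw [hAg] at h1
    rw [Ne, hBg] at h2
    obtain ⟨xs, hw, hxs⟩ := h1
    rw [hw, hdec]
    refine ⟨rfl, hxs, ?_⟩
    by_contra hmem
    exact h2 ⟨xs, hw, fun u hu h => hmem (h ▸ hu)⟩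
  have hcert : ∀ g, Certifies R (fun x => outr x 0) f g.1 g.2.1 g.2.2 ↔
      D₁ g ∧ ¬ (E g).head? = some true := by
    intro g
    constructor
    · rintro ⟨xs, hw, h1, h2, h3⟩
      refine ⟨⟨(hAg g).mpr ⟨xs, hw, h1⟩, fun h => ?_⟩, ?_⟩
      · obtain ⟨xs', hw', h⟩ := (hBg g).mp h
        rw [hw] at hw'
        rw [← encodeList_injective hw'] at h
        exact h _ h2 rfl
      · rw [hEg, hw, hdec]; exact h3
    · rintro ⟨h1, h2⟩
      obtain ⟨h3, h4, h5⟩ := hD₁ g h1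
      rw [hEg] at h2
      exact ⟨_, h3, h4, h5, h2⟩
  change ∃ V, PolyRun O V (fun _ => True)
      (fun g : List Bool × List Bool × List Bool => input [g.1, g.2.1, g.2.2])
      (fun g t => (t 0).head? = some true ↔
        Certifies R (fun x => outr x 0) f g.1 g.2.1 g.2.2)
  have hpush : ∀ (b : Bool) (D' : List Bool × List Bool × List Bool → Prop)
      (l : List Bool × List Bool × List Bool → List (List Bool)), (∀ g, l g ≠ []) →
      (∀ g, D' g → (b = true ↔ Certifies R (fun x => outr x 0) f g.1 g.2.1 g.2.2)) →
      PolyRun O (.push 0 b) D' (fun g => input (l g)) (fun g t => (t 0).head? = some true ↔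
        Certifies R (fun x => outr x 0) f g.1 g.2.1 g.2.2) := by
    intro b D' l hl h
    have hl : ∀ g, 0 < (l g).length := fun g => List.length_pos_of_ne_nil (hl g)
    refine (PolyStep.push fun g _ => hl g).mono (fun _ h => h) ?_
    rintro g t hg rfl
    rw [← h g hg]
    simp [input_apply, hl g]
  have h1 : PolyStep O (call 3 [0] cr 1) (fun _ => True)
      (fun g : List Bool × List Bool × List Bool => [g.1, g.2.1, g.2.2])
      (fun g => [g.1, g.2.1, g.2.2, outr g.1 0]) :=
    PolyRun.call 1 (by simp) (by simp) (hr.reindex Prod.fst)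
  have h2 : PolyStep O (call 4 [2, 3] cA 1) (fun _ => True)
      (fun g : List Bool × List Bool × List Bool => [g.1, g.2.1, g.2.2, outr g.1 0])
      (fun g => [g.1, g.2.1, g.2.2, outr g.1 0, A g]) :=
    .call_pair hA (by simp) (by simp) (by simp)
  have h3 : PolyStep O (call 5 [2, 3] cN 1) (fun g => True ∧ (A g).head? = some true)
      (fun g : List Bool × List Bool × List Bool => [g.1, g.2.1, g.2.2, outr g.1 0, A g])
      (fun g => [g.1, g.2.1, g.2.2, outr g.1 0, A g, B g]) :=
    .call_pair hN (by simp) (by simp) (by simp)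
  have h4 : PolyStep O (call 6 [2] cc 2) D₁
      (fun g : List Bool × List Bool × List Bool => [g.1, g.2.1, g.2.2, outr g.1 0, A g, B g])
      (fun g => [g.1, g.2.1, g.2.2, outr g.1 0, A g, B g,
        outc (dec g.2.2) 0, outc (dec g.2.2) 1]) := by
    refine PolyRun.call (out := fun g : List Bool × List Bool × List Bool => outc (dec g.2.2)) 2 (by simp) (by simp) ?_
    refine ((hc.reindex fun g : List Bool × List Bool × List Bool => dec g.2.2).mono
      (fun g hg => ?_) fun _ _ _ h => h).congr_input fun g hg => ?_
    · exact hD _ _ (hD₁ g hg).2.2 (hD₁ g hg).2.1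
    · rw [← (hD₁ g hg).1]
      rfl
  have h5 : PolyStep O (call 8 [6, 7] ck 1) D₁
      (fun g : List Bool × List Bool × List Bool => [g.1, g.2.1, g.2.2, outr g.1 0, A g, B g,
        outc (dec g.2.2) 0, outc (dec g.2.2) 1])
      (fun g => [g.1, g.2.1, g.2.2, outr g.1 0, A g, B g,
        outc (dec g.2.2) 0, outc (dec g.2.2) 1, f (dec g.2.2)]) := by
    refine PolyRun.call (out := fun g : List Bool × List Bool × List Bool => outk (outc (dec g.2.2) 0, (outc (dec g.2.2) 1).length)) 1
      (by simp) (by simp) ?_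
    refine ((hk.reindex fun g : List Bool × List Bool × List Bool =>
      (outc (dec g.2.2) 0, (outc (dec g.2.2) 1).length)).mono
      (fun _ _ => trivial) fun _ _ _ h => h).congr_input fun g hg => ?_
    -- The second output of `cc` is already in unary, the form in which `ck` expects its parameter.
    rw [← hcu _ (hD _ _ (hD₁ g hg).2.2 (hD₁ g hg).2.1)]
    rfl
  have h6 : PolyStep O (call 9 [1, 8] cN 1) D₁
      (fun g : List Bool × List Bool × List Bool => [g.1, g.2.1, g.2.2, outr g.1 0, A g, B g,
        outc (dec g.2.2) 0, outc (dec g.2.2) 1, f (dec g.2.2)])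
      (fun g => [g.1, g.2.1, g.2.2, outr g.1 0, A g, B g,
        outc (dec g.2.2) 0, outc (dec g.2.2) 1, f (dec g.2.2), E g]) :=
    .call_pair hN (by simp) (by simp) (by simp)
  have hfin := h4.seq (h5.seq (h6.seq (.cond (i := 9)
    (hpush true _ _ (by simp) fun g ⟨hg, h⟩ => by
      have h : E g = [] := h
      rw [hcert]; simp [hg, h])
    (hpush true _ _ (by simp) fun g ⟨hg, h⟩ => by
      have h : (E g).head? = some false := h
      rw [hcert]; simp [hg, h])
    (hpush false _ _ (by simp) fun g ⟨hg, h⟩ => by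
      have h : (E g).head? = some true := h
      rw [hcert]; simp [h]))))
  refine ⟨_, h1.seq (h2.seq (.cond (i := 4) (hpush false _ _ (by simp) fun g ⟨_, h⟩ => ?_)
    (hpush false _ _ (by simp) fun g ⟨_, h⟩ => ?_) (h3.seq (.cond (i := 5)
      (hfin.mono (fun g ⟨⟨_, h⟩, h'⟩ => ?_) fun _ _ _ h => h)
      (hfin.mono (fun g ⟨⟨_, h⟩, h'⟩ => ?_) fun _ _ _ h => h)
      (hpush false _ _ (by simp) fun g ⟨_, h⟩ => ?_)))))⟩
  · have h : A g = [] := h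
    rw [hcert]; simp [D₁, h]
  · have h : (A g).head? = some false := h
    rw [hcert]; simp [D₁, h]
  · have h' : B g = [] := h'
    exact ⟨h, by simp [h']⟩
  · have h' : (B g).head? = some false := h'
    exact ⟨h, by simp [h']⟩
  · have h : (B g).head? = some true := h
    rw [hcert]; simp [D₁, h]

/-! ### The theorem -/

/-- A kernel is a compression: its output can be written as one string. -/
theorem HasPolyKernel.exists_hasPolyCompression {P : ParamProblem} (h : HasPolyKernel P) :
    ∃ Q, HasPolyCompression P Q := by
  obtain ⟨O, hO, c, q, b, h⟩ := h
  have hinj : ∀ {x y : List Bool} {r k : ℕ},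
      unary r ++ false :: x = unary k ++ false :: y → r = k ∧ x = y := by
    intro x y r
    induction r with
    | zero => rintro (_ | k) h <;> simp_all [unary, List.replicate_succ]
    | succ r ih =>
      rintro (_ | k) h
      · simp [unary, List.replicate_succ] at h
      · have h' : unary r ++ false :: x = unary k ++ false :: y := by
          simpa [unary, List.replicate_succ] using h
        obtain ⟨rfl, rfl⟩ := ih h'
        exact ⟨rfl, rfl⟩
  refine ⟨{z | ∃ x r, (x, r) ∈ P ∧ z = unary r ++ false :: x}, O, hO,
    -- A separator and then the parameter go on top of the string. `move` reverses the parameter,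
    -- which is harmless in unary.
    .seq c (.seq (.push 0 false) (move 1 0)), q + 4 * b + 2, b + 1, fun x r => ?_⟩
  obtain ⟨s, x', r', ⟨m, hm, hr⟩, hs0, hs1, hle, hP⟩ := h x r
  have h1 := Run.push (O := O) 0 false s
  have h2 := run_move O (i := 1) (j := 0) (by omega) (update s 0 (false :: s 0))
  refine ⟨_, _, ⟨m + (1 + _), ?_, hr.seq (h1.seq h2)⟩, rfl, ?_, ?_⟩
  · have := eval_mono b (Nat.le_add_left r x.length)
    simp only [Polynomial.eval_add, Polynomial.eval_mul, Polynomial.eval_ofNat]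
    simp [hs1, unary]
    omega
  · simp [hs0, hs1, unary]
    omega
  · have e : update (update (update s 0 (false :: s 0)) 0
        ((update s 0 (false :: s 0) 1).reverse ++ update s 0 (false :: s 0) 0)) 1 [] 0 =
        unary r' ++ false :: x' := by
      simp [hs0, hs1, unary]
    rw [e, ← hP]
    constructor
    · rintro ⟨y, k, hyk, he⟩
      obtain ⟨rfl, rfl⟩ := hinj he
      exact hyk
    · intro hx
      exact ⟨x', r', hx, rfl⟩

theorem length_input_singleton_le (x : List Bool) (i : ℕ) : (input [x] i).length ≤ x.length := by
  rcases i with _ | i <;> simp [input_apply]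

/-- A program cannot write more symbols than it makes steps, which bounds the length of the reduced
instance. -/
theorem PolyReducible.polyRun {A L : Problem} (h : PolyReducible A L) :
    ∃ (c : Prog) (b : Polynomial ℕ), PolyRun ∅ c (fun _ => True) (fun x => input [x])
      (fun x t => (t 0).length ≤ b.eval x.length ∧ (x ∈ A ↔ t 0 ∈ L)) := by
  obtain ⟨c, q, h⟩ := h
  refine ⟨c, Polynomial.X + q, q, fun x _ N hN => ?_⟩
  obtain ⟨s, ⟨m, hm, hr⟩, hs⟩ := h x
  refine ⟨m, hm.trans (eval_mono q (hN 0)), s, hr, ?_, hs⟩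
  have := (hr.length_le 0).trans (Nat.add_le_add (length_input_singleton_le x 0) hm)
  simpa using this

/-- A compression and an OR-cross-composition of a `Σ₂ᴾ`-hard problem put `Π₂ᴾ` into
`Σ₂ᴾ/poly`. -/
theorem piTwo_subset_of_hasPolyCompression {L Q : Problem} {P : ParamProblem}
    (hL : SigmaTwoHard L) (hLP : ORCrossComposes L P) (hPQ : HasPolyCompression P Q) :
    PiTwo ⊆ SigmaTwoPoly := by
  intro A hA
  obtain ⟨R, ⟨⟨O₁, hO₁, cR, qR, hR⟩, bR, hbR⟩, O₂, hO₂, cc, qc, bc, hc⟩ := hLP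
  obtain ⟨O₃, hO₃, ck, qk, bk, hk⟩ := hPQ
  obtain ⟨cr, br, hr⟩ := (hL _ hA).polyRun
  -- One oracle for the equivalence test, the cross-composition and the compression. The summand `∅`
  -- serves the reduction, whose queries must still be answered in the negative.
  set J := join (join O₁ O₂) (join O₃ ∅)
  have hJNP : J ∈ NP := join_mem_NP (join_mem_NP hO₁ hO₂) (join_mem_NP hO₃ empty_mem_NP)
  have hJ₁ : Simulates J O₁ := (simulates_join_left _ _).trans (simulates_join_left _ _)
  have hJ₂ : Simulates J O₂ := (simulates_join_left _ _).trans (simulates_join_right _ _)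
  have hJ₃ : Simulates J O₃ := (simulates_join_right _ _).trans (simulates_join_left _ _)
  have hJ₀ : Simulates J ∅ := (simulates_join_right _ _).trans (simulates_join_right _ _)
  obtain ⟨cr, hr⟩ := hr.simulate hJ₀
  obtain ⟨outr, hr, houtr⟩ := PolyRun.exists_fun (l := fun x => [x]) hr
  obtain ⟨cR, hR⟩ := (decides_of_accepts (p := fun x y => R x y) qR (fun x y => (hR x y).1)
    fun x y => (hR x y).2).simulate hJ₁
  let D : List (List Bool) → Prop := fun xs => xs ≠ [] ∧ ∀ x ∈ xs, ∀ y ∈ xs, R x y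
  have hc : PolyRun O₂ cc D (fun xs => input [encodeList xs])
      (fun xs t => t 1 = unary (t 1).length ∧
        (t 1).length ≤ bc.eval (xs.toFinset.sup List.length + Nat.log 2 xs.length) ∧
        ((t 0, (t 1).length) ∈ P ↔ ∃ x ∈ xs, x ∈ L)) := by
    refine ⟨qc, fun xs ⟨h1, h2⟩ N hN => ?_⟩
    obtain ⟨s, y, k, ⟨m, hm, hrun⟩, rfl, hs1, hle, hP⟩ := hc xs h1 h2
    have hlen : (s 1).length = k := by simp [hs1, unary]
    exact ⟨m, hm.trans (eval_mono qc (hN 0)), s, hrun, by rw [hlen, hs1], by rwa [hlen],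
      by rwa [hlen]⟩
  obtain ⟨cc, hc⟩ := hc.simulate hJ₂
  obtain ⟨outc, hc, houtc⟩ := PolyRun.exists_fun (l := fun xs => [encodeList xs]) hc
  have hk : PolyRun O₃ ck (fun _ => True) (fun g => input [g.1, unary g.2])
      (fun (g : List Bool × ℕ) t => (t 0).length ≤ bk.eval g.2 ∧ (t 0 ∈ Q ↔ g ∈ P)) := by
    refine ⟨qk.comp (2 * Polynomial.X), fun g _ N hN => ?_⟩
    obtain ⟨s, y, ⟨m, hm, hrun⟩, rfl, hle, hP⟩ := hk g.1 g.2
    have h0 : g.1.length ≤ N := hN 0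
    have h1 : g.2 ≤ N := by simpa [input_apply, unary] using hN 1
    refine ⟨m, hm.trans ?_, s, hrun, hle, hP⟩
    simp only [Polynomial.eval_comp, Polynomial.eval_mul, Polynomial.eval_ofNat,
      Polynomial.eval_X]
    exact eval_mono _ (by omega)
  obtain ⟨ck, hk⟩ := hk.simulate hJ₃
  obtain ⟨outk, hk, houtk⟩ :=
    PolyRun.exists_fun (l := fun g : List Bool × ℕ => [g.1, unary g.2]) hk
  obtain ⟨V, qV, hV⟩ := exists_verifier hr hR hc (fun xs h => (houtc xs h).1) hk
    (fun xs z hz h => ⟨List.ne_nil_of_mem hz,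
      fun x hx y hy => R.trans (h x hx) (R.symm (h y hy))⟩)
  set ρ : List Bool → List Bool := fun x => outr x 0
  set f : List (List Bool) → List Bool :=
    fun xs => outk (outc xs 0, (outc xs 1).length) 0
  have hρ : ∀ x, (ρ x).length ≤ br.eval x.length ∧ (x ∈ Aᶜ ↔ ρ x ∈ L) := fun x => houtr x trivial
  have hf : ∀ xs, D xs → (f xs).length ≤
      bk.eval (bc.eval (xs.toFinset.sup List.length + Nat.log 2 xs.length)) ∧
      (f xs ∈ Q ↔ ∃ x ∈ xs, x ∈ L) := by
    intro xs hxs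
    obtain ⟨-, h1, h2⟩ := houtc xs hxs
    obtain ⟨h3, h4⟩ := houtk (outc xs 0, (outc xs 1).length) trivial
    exact ⟨h3.trans (eval_mono bk h1), h4.trans h2⟩
  obtain ⟨T, hT⟩ := exists_polynomial_tuple_length (bk.comp bc)
  choose t htT ht using hT
  have hadv : ∀ n, ∃ ys : List (List Bool),
      ys.length ≤ bR.eval (br.eval n) * (n + 1) ∧
      (∀ y ∈ ys, y.length ≤ T.eval (br.eval n) ∧ y ∉ Q) ∧
      ∀ x : List Bool, x.length = n → ρ x ∉ L → ∃ xs : List (List Bool),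
        xs.length = t (br.eval n) ∧ (∀ u ∈ xs, u.length ≤ br.eval n ∧ R u (ρ x)) ∧
        ρ x ∈ xs ∧ f xs ∈ ys := by
    intro n
    have ht := ht (br.eval n)
    rw [Polynomial.eval_comp] at ht
    obtain ⟨ys, h1, h2, h3⟩ := exists_certifying_values (R := R) (L := L) (Q := Q) (ρ := ρ) (f := f)
      (n := n) (m := br.eval n) (c := bR.eval (br.eval n)) (t := t (br.eval n))
      (B := bk.eval (bc.eval (br.eval n + Nat.log 2 (t (br.eval n)))))
      (fun x hx => hx ▸ (hρ x).1) (fun S hS => (hbR S).trans (eval_mono bR hS))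
      (fun xs hxs hRxs hm => by
        -- The tuple length is positive because `ht` makes it at least one more than a natural
        -- number.
        have hne : xs ≠ [] := by rintro rfl; simp at hxs; omega
        obtain ⟨h, h'⟩ := hf xs ⟨hne, hRxs⟩
        refine ⟨h.trans (eval_mono bk (eval_mono bc ?_)), h'⟩
        rw [hxs]
        exact Nat.add_le_add_right (Finset.sup_le fun x hx => hm x (by simpa using hx)) _) ht
    refine ⟨ys, h1, fun y hy => ⟨(h2 y hy).1.trans ?_, (h2 y hy).2⟩, h3⟩
    -- The length bound on the values is smaller than `t`, hence at most `T`.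
    have := htT (br.eval n)
    omega
  choose ys hys hysQ hcov using hadv
  have hN : ∀ (x a w : List Bool) (i : ℕ),
      (input [x, a, w] i).length ≤ x.length + a.length + w.length := by
    intro x a w i
    rcases i with _ | _ | _ | i <;> simp [input_apply] <;> omega
  have hacc : ∀ x a w, Accepts J V [x, a, w] ↔ Certifies R ρ f x a w := by
    intro x a w
    obtain ⟨m, -, s, hrun, hs⟩ := hV (x, a, w) trivial _ (hN x a w)
    refine Iff.trans ⟨?_, fun h => ⟨m, s, hrun, h⟩⟩ hs
    rintro ⟨m', s', hrun', h⟩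
    rwa [(hrun.unique hrun').2]
  -- A certificate encodes at most `T` strings of length at most `br`; the advice encodes at most
  -- `bR * (n + 1)` strings of length at most `T`. Each string of length at most `k` costs at most
  -- `2 * k + 1` symbols.
  refine ⟨J, hJNP, V, T.comp br * (2 * br + 1), qV,
    bR.comp br * (Polynomial.X + 1) * (2 * T.comp br + 1), fun n => encodeList (ys n),
    fun n => ?_, fun x a w => ?_, fun x => ?_⟩
  · refine (length_encodeList_le fun y hy => (hysQ n y hy).1).trans ?_
    simp only [Polynomial.eval_add, Polynomial.eval_mul, Polynomial.eval_comp, Polynomial.eval_X,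
      Polynomial.eval_one, Polynomial.eval_ofNat]
    gcongr
    exact hys n
  · obtain ⟨m, hm, s, hrun, -⟩ := hV (x, a, w) trivial _ (hN x a w)
    exact ⟨m, hm, s, hrun⟩
  · simp only [hacc]
    have hxA : x ∈ A ↔ ρ x ∉ L := by rw [← (hρ x).2]; simp
    rw [hxA]
    constructor
    · intro hx
      obtain ⟨xs, h1, h2, h3, h4⟩ := hcov x.length x rfl hx
      refine ⟨encodeList xs, (length_encodeList_le fun u hu => (h2 u hu).1).trans ?_,
        xs, rfl, fun u hu => (h2 u hu).2, h3, ?_⟩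
      · simp only [Polynomial.eval_add, Polynomial.eval_mul, Polynomial.eval_comp,
          Polynomial.eval_one, Polynomial.eval_ofNat]
        rw [h1]
        gcongr
        exact htT _
      · rintro ⟨ys', he, h⟩
        rw [← encodeList_injective he] at h
        exact h _ h4 rfl
    -- Soundness needs neither the length of the certificate nor the number of its entries: a value
    -- outside `Q` excludes entries in `L` for every non-empty tuple of equivalent strings.
    · rintro ⟨w, -, xs, -, h1, h2, h3⟩ hx
      have hmem : f xs ∈ ys x.length := by
        by_contra hmem
        exact h3 ⟨_, rfl, fun y hy h => hmem (h ▸ hy)⟩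
      have hD : D xs := ⟨List.ne_nil_of_mem h2,
        fun u hu v hv => R.trans (h1 u hu) (R.symm (h1 v hv))⟩
      exact (hysQ _ _ hmem).2 ((hf xs hD).2.mpr ⟨_, h2, hx⟩)

end PNP

theorem theorem4p1 (L : PNP.Problem) (P : PNP.ParamProblem)
    (hL : PNP.SigmaTwoHard L) (hLP : PNP.ORCrossComposes L P)
    (hcollapse : ¬ PNP.PiTwo ⊆ PNP.SigmaTwoPoly) :
    ¬ PNP.HasPolyKernel P ∧ ¬ ∃ Q : PNP.Problem, PNP.HasPolyCompression P Q := by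
  have h : ¬ ∃ Q : PNP.Problem, PNP.HasPolyCompression P Q := fun ⟨_, hQ⟩ =>
    hcollapse (PNP.piTwo_subset_of_hasPolyCompression hL hLP hQ)
  exact ⟨fun hk => h hk.exists_hasPolyCompression, h⟩
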